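/- Consider $n$ agents with independent values $v_i\ge 0$, $v_i\sim F_i$, and a seller who may serve any set of agents in $\mathcal J\subseteq 2^{[n]}$, where $([n],\mathcal J)$ is a partition matroid: $[n]$ is partitioned into blocks with capacities, and $S\in\mathcal J$ iff $S$ contains at most $\mathrm{cap}(B)$ agents of each block $B$ (a $k$-unit auction is the case of one block of capacity $k$). A mechanism maps each value vector $v$ to a set in $\mathcal J$ and to payments; it is truthful if it is dominant-strategy incentive compatible and individually rational, payments are nonnegative, and unserved agents pay nothing. For $q\in(0,1]$ let $F_i^{-1}(1-q)$ denote the largest price $p$ with $\Pr[v_i\ge p]\ge q$, and let $R_i(q)=q\,F_i^{-1}(1-q)$, $R_i(0)=0$. A sequential posted-price mechanism (SPM) has an order on the agents and independently drawn random offers. It approaches the agents in this order, starting from $A=\emptyset$; if $A\cup\{i\}\in\mathcal J$ it makes agent $i$ her offer (a price $p$, or no offer), and $i$ is added to $A$ and pays $p$ iff $v_i\ge p$. The $q$-offer to agent $i$ is the price $p=F_i^{-1}(1-q)$ with probability $q/\Pr[v_i\ge p]$, and no offer otherwise (always no offer if $q=0$); so it would be accepted with probability exactly $q$, and it is the price $p$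 with certainty if $q>0$ and $F_i$ has no point masses. **(Regular case.)** Let every $F_i$ have a density $f_i$, where point masses are allowed and $f_i=\infty$ at exactly these, and let every virtual value $\phi_i(v)=v-\frac{1-F_i(v)}{f_i(v)}$ be nondecreasing in $v$ (with $\phi_i=-\infty$ where $f_i=0$ and $F_i<1$, and $\phi_i(v)=v$ where $F_i(v)=1$). Let $M$ be Myerson's mechanism, i.e. a truthful mechanism which almost surely serves a set $S\in\mathcal J$ maximizing $\sum_{i\in S}\phi_i(v_i)$ (ties broken arbitrarily). Let $q_i$ be the probability that $M$ serves $i$, and let $\mathcal S$ be the SPM that makes the $q_i$-offer to agent $i$ and approaches the agents in decreasing order of the prices $F_i^{-1}(1-q_i)$ (ties broken arbitrarily; agents with $q_i=0$ count as price $0$). Then $$\mathrm{Rev}(M)\le \frac{e}{e-1}\,\mathrm{Rev}(\mathcal S),$$ where $\mathrm{Rev}$ denotes expected revenue. **(General case.)** Let the $F_i$ be arbitrary with $\sup_v v\Pr[v_i\ge v]<\infty$. Let $\bar R_i$ be the least concave majorant of $R_i$ on $[0,1]$, let the ironed virtual value $\bar\phi_i(v)$ be the left derivative of $\bar R_i$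 at $\Pr[v_i\ge v]$, and let $M$ be Myerson's mechanism defined as above with $\bar\phi_i$ in place of $\phi_i$, with serving probabilities $q_i$. Suppose that $x_i,\underline q_i,\overline q_i\in[0,1]$ satisfy $x_i\underline q_i+(1-x_i)\overline q_i=q_i$ and $x_iR_i(\underline q_i)+(1-x_i)R_i(\overline q_i)=\bar R_i(q_i)$ for all $i$. Let $\mathcal S$ be the SPM that makes agent $i$ the $\underline q_i$-offer with probability $x_i$ and the $\overline q_i$-offer with probability $1-x_i$, and approaches the agents in decreasing order of $\bar R_i(q_i)/q_i$ (taken as $0$ if $q_i=0$; ties broken arbitrarily). Then again $$\mathrm{Rev}(M)\le \frac{e}{e-1}\,\mathrm{Rev}(\mathcal S).$$ Moreover, such $x_i,\underline q_i,\overline q_i$ exist for every $i$ for which $v\Pr[v_i\ge v]\to0$ as $v\to\infty$ (for example if $v_i$ has finite mean). -/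

import Mathlib

open MeasureTheory Set Filter Topology
open scoped ENNReal

noncomputable section

namespace SeqPosted

/-! ### Instances and truthful mechanisms -/

/-- A Bayesian single-parameter mechanism design instance with `n` agents: independent nonnegative
values `v i ∼ dist i` and a downward closed family of feasible sets of agents. -/
structure BSMD (n : ℕ) where
  dist : Fin n → Measure ℝ
  prob : ∀ i, IsProbabilityMeasure (dist i)
  nonneg : ∀ i, dist i (Iio 0) = 0
  feasible : Set (Finset (Fin n))
  downward : ∀ A B : Finset (Fin n), A ⊆ B → B ∈ feasible → A ∈ feasible

instance {n : ℕ} (I : BSMD n) (i : Fin n) : IsProbabilityMeasure (I.dist i) := I.prob i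

/-- Partition matroid (disjoint union of uniform matroids): the agents are partitioned into blocks,
and at most `cap j` agents of block `j` can be served. A `k`-uniform matroid is the case of a
single block with capacity `k`. -/
def IsPartitionMatroid {n : ℕ} (J : Set (Finset (Fin n))) : Prop :=
  ∃ (block : Fin n → ℕ) (cap : ℕ → ℕ),
    ∀ S : Finset (Fin n), S ∈ J ↔ ∀ j, (S.filter (fun i => block i = j)).card ≤ cap j

/-- The joint law of the value vector. -/
def BSMD.law {n : ℕ} (I : BSMD n) : Measure (Fin n → ℝ) := Measure.pi I.dist

/-- A (direct) mechanism: a feasible allocation and a payment for every vector of values. -/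
structure Mechanism {n : ℕ} (I : BSMD n) where
  alloc : (Fin n → ℝ) → Finset (Fin n)
  pay : (Fin n → ℝ) → Fin n → ℝ
  alloc_mem : ∀ v, alloc v ∈ I.feasible
  measurable_alloc : ∀ i, MeasurableSet {v | i ∈ alloc v}
  measurable_pay : ∀ i, Measurable (fun v => pay v i)

namespace Mechanism

variable {n : ℕ} {I : BSMD n}

open Classical in
/-- Utility of agent `i` with true value `x` when the reported values are `w`. -/
def utility (M : Mechanism I) (i : Fin n) (x : ℝ) (w : Fin n → ℝ) : ℝ :=
  (if i ∈ M.alloc w then x else 0) - M.pay w i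

/-- Truthfulness (in dominant strategies), individual rationality, nonnegative payments, and agents
that are not served pay nothing. -/
structure Truthful (M : Mechanism I) : Prop where
  pay_nonneg : ∀ v, 0 ≤ v → ∀ i, 0 ≤ M.pay v i
  pay_unserved : ∀ v, 0 ≤ v → ∀ i, i ∉ M.alloc v → M.pay v i = 0
  rational : ∀ v, 0 ≤ v → ∀ i, 0 ≤ M.utility i (v i) v
  truthful : ∀ v, 0 ≤ v → ∀ i, ∀ z : ℝ, 0 ≤ z →
    M.utility i (v i) (Function.update v i z) ≤ M.utility i (v i) v

/-- Expected revenue of a mechanism. -/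
def revenue (M : Mechanism I) : ℝ≥0∞ :=
  ∫⁻ v, ENNReal.ofReal (∑ i, M.pay v i) ∂I.law

/-- The probability that the mechanism serves agent `i`. -/
def serveProb (M : Mechanism I) (i : Fin n) : ℝ :=
  (I.law {v | i ∈ M.alloc v}).toReal

/-- Myerson's mechanism for the (ironed) virtual value functions `φ i`: a truthful mechanism that
(almost surely) serves a feasible set maximizing the (ironed) virtual surplus
`∑ i ∈ S, φ i (v i)`; ties are broken arbitrarily. -/
def IsMyerson (M : Mechanism I) (φ : Fin n → ℝ → EReal) : Prop :=
  M.Truthful ∧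
    ∀ᵐ v ∂I.law, ∀ S ∈ I.feasible, ∑ i ∈ S, φ i (v i) ≤ ∑ i ∈ M.alloc v, φ i (v i)

end Mechanism

/-! ### Virtual values and regularity -/

/-- `f` is a density of `μ`, with the convention that the density is infinite exactly at the point
masses of `μ`. When `μ` has no point masses, this says that `f` is a finite-valued density. -/
structure IsDensity (μ : Measure ℝ) (f : ℝ → ℝ≥0∞) : Prop where
  measurable : Measurable f
  eq_top_iff : ∀ v, f v = ⊤ ↔ μ {v} ≠ 0
  eq_add : μ = volume.withDensity f + μ.restrict {v | f v = ⊤}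

/-- The virtual value `v - (1 - F v) / f v`; it is `v` at a point mass, and `-∞` where the density
vanishes while `1 - F v > 0`. -/
def virtualValue (μ : Measure ℝ) (f : ℝ → ℝ≥0∞) (v : ℝ) : EReal :=
  (v : EReal) - ((μ (Ioi v) / f v : ℝ≥0∞) : EReal)

/-- Regularity: the virtual value is nondecreasing. -/
def IsRegular (μ : Measure ℝ) (f : ℝ → ℝ≥0∞) : Prop := Monotone (virtualValue μ f)

/-! ### Prices, revenue curves, ironing -/

/-- The probability that the value is at least `p`, i.e. that a price of `p` is accepted. -/
def acceptProb (μ : Measure ℝ) (p : ℝ) : ℝ := (μ (Ici p)).toReal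

/-- The price `F⁻¹ (1 - q)`, i.e. the largest price accepted with probability at least `q`
(for `0 < q ≤ 1`). -/
def quantilePrice (μ : Measure ℝ) (q : ℝ) : ℝ := sSup {p | q ≤ acceptProb μ p}

/-- The revenue curve `q ↦ q * F⁻¹ (1 - q)`. -/
def revenueCurve (μ : Measure ℝ) (q : ℝ) : ℝ := q * quantilePrice μ q

/-- The ironed revenue curve: the least concave majorant of the revenue curve on `[0, 1]`. -/
def ironedCurve (μ : Measure ℝ) (q : ℝ) : ℝ :=
  sInf {y | ∃ h : ℝ → ℝ, ConcaveOn ℝ (Icc 0 1) h ∧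
    (∀ r ∈ Icc (0 : ℝ) 1, revenueCurve μ r ≤ h r) ∧ y = h q}

/-- The ironed virtual value of `v`: the (left) derivative of the ironed revenue curve at the
quantile of `v`. On the quantile range `(P(V > v), P(V ≥ v))` of a point mass `v` the ironed curve
is linear, and the left derivative at `P(V ≥ v)` is its slope there. -/
def ironedVirtualValue (μ : Measure ℝ) (v : ℝ) : ℝ :=
  derivWithin (ironedCurve μ) (Iic (acceptProb μ v)) (acceptProb μ v)

/-! ### Sequential posted-price mechanisms -/

open Classical in
/-- The set of agents served when the agents in the list `l` are approached in turn, agent `i` being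
made an offer if it can be feasibly added to the agents served so far, and accepting it iff
`acc i`. -/
def servedSet {n : ℕ} (J : Set (Finset (Fin n))) (acc : Fin n → Prop) (l : List (Fin n)) :
    Finset (Fin n) :=
  l.foldl (fun A i => if insert i A ∈ J ∧ acc i then insert i A else A) ∅

/-- The expected revenue of the sequential posted-price mechanism with order
`σ 0, σ 1, …, σ (n - 1)`, where the price for agent `i` is drawn independently from `ν i`; a price
of `⊤` stands for not making an offer. In `w i`, the first component is the value of agent `i` and
the second one the price for agent `i`. -/
def BSMD.spmRevenue {n : ℕ} (I : BSMD n) (σ : Equiv.Perm (Fin n)) (ν : Fin n → Measure EReal) :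
    ℝ≥0∞ :=
  ∫⁻ w : Fin n → ℝ × EReal,
    ∑ i ∈ servedSet I.feasible (fun i => (w i).2 ≤ ((w i).1 : EReal)) (List.ofFn σ),
      (w i).2.toENNReal
    ∂(Measure.pi (fun i => (I.dist i).prod (ν i)))

/-- The random offer with overall acceptance probability `q`: the price `p = F⁻¹ (1 - q)` is offered
with probability `q / P(V ≥ p)` (which is `1` if `0 < q` and there are no point masses), and no
offer is made otherwise. -/
def quantileOffer (μ : Measure ℝ) (q : ℝ) : Measure EReal :=
  let p := quantilePrice μ q
  ENNReal.ofReal (q / acceptProb μ p) • Measure.dirac (p : EReal) +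
    ENNReal.ofReal (1 - q / acceptProb μ p) • Measure.dirac (⊤ : EReal)

/-- A lottery: use the selling probability `lo` with probability `x`, and `hi` with probability
`1 - x`. -/
structure Lottery where
  x : ℝ
  lo : ℝ
  hi : ℝ

namespace Lottery

/-- The expected revenue of the lottery from a single agent. -/
def value (L : Lottery) (μ : Measure ℝ) : ℝ :=
  L.x * revenueCurve μ L.lo + (1 - L.x) * revenueCurve μ L.hi

/-- The lottery sells with total probability `q`, and its revenue is the value of the ironed revenue
curve at `q`. -/
structure IsOptimal (L : Lottery) (μ : Measure ℝ) (q : ℝ) : Prop where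
  x_mem : L.x ∈ Icc (0 : ℝ) 1
  lo_mem : L.lo ∈ Icc (0 : ℝ) 1
  hi_mem : L.hi ∈ Icc (0 : ℝ) 1
  prob_eq : L.x * L.lo + (1 - L.x) * L.hi = q
  value_eq : L.value μ = ironedCurve μ q

/-- The random offer that uses the price `F⁻¹ (1 - lo)` with probability `x` and the price
`F⁻¹ (1 - hi)` with probability `1 - x`. -/
def offer (L : Lottery) (μ : Measure ℝ) : Measure EReal :=
  ENNReal.ofReal L.x • quantileOffer μ L.lo + ENNReal.ofReal (1 - L.x) • quantileOffer μ L.hi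

end Lottery

end SeqPosted

end

/-! Both revenues are compared with the ex ante benchmark: the sum over the agents of the value at
`q i` of the revenue curve (ironed in the general case), as if each agent were sold to separately
with probability `q i`.

Upper bound. With the other values fixed, a truthful mechanism confronts agent `i` with a fixed
price, so her expected payment is at most her revenue curve at her conditional serving probability
(`lintegral_pay_le_revenueCurve`). That probability has mean `q i`, so an affine majorant of the
curve yields Jensen's inequality (`lintegral_pay_le_of_affine`). A supporting line of the ironed
curve is such a majorant. For a regular distribution there is one through the point of the revenue
curve itself at `q i`, since the price there maximizes the Lagrangian `(t - c) * P(V ≥ t)`, with `c`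
its virtual value (`exists_affine_majorant_of_isRegular`).

Lower bound. Offers are accepted independently with probabilities `q i`, which sum to at most the
capacity in each block. In a partition matroid the greedy process serves `min cap X` of the `X`
accepting agents of a block, and `E[min k X] ≥ (1 - 1/e) E[X]` for a sum `X` of independent
indicators with mean at most `k` (`le_integral_min_card`). So every prefix of the order sells at
least a `1 - 1/e` fraction of its ex ante quantity; as the expected revenue per sale decreases along
the order, summation by parts transfers this to revenue (`exists_revenue_lower_bound`).

Optimal lotteries exist because a supporting line of the ironed curve at `q` touches an upper
semicontinuous revenue curve on both sides of `q` (`exists_contact_left`, `exists_contact_right`).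
-/

namespace SeqPosted

/-! ### Quantile prices and acceptance probabilities -/

section Quantile

lemma acceptProb_nonneg {μ : Measure ℝ} (p : ℝ) : 0 ≤ acceptProb μ p := ENNReal.toReal_nonneg

lemma revenueCurve_zero {μ : Measure ℝ} : revenueCurve μ 0 = 0 := by simp [revenueCurve]

variable {μ : Measure ℝ} [IsProbabilityMeasure μ]

lemma acceptProb_antitone : Antitone (acceptProb μ) := fun _ _ h =>
  ENNReal.toReal_mono (measure_ne_top _ _) (measure_mono (Ici_subset_Ici.2 h))

lemma acceptProb_of_nonpos (h0 : μ (Iio 0) = 0) {p : ℝ} (hp : p ≤ 0) : acceptProb μ p = 1 := by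
  have h : μ (Ici p) = 1 := by
    rw [prob_compl_eq_zero_iff measurableSet_Ici |>.symm, compl_Ici]
    exact measure_mono_null (Iio_subset_Iio hp) h0
  simp [acceptProb, h]

lemma ofReal_acceptProb (p : ℝ) : ENNReal.ofReal (acceptProb μ p) = μ (Ici p) :=
  ENNReal.ofReal_toReal (measure_ne_top _ _)

lemma tendsto_acceptProb_atTop : Tendsto (acceptProb μ) atTop (𝓝 0) := by
  have h := tendsto_measure_iInter_atTop (μ := μ) (s := fun x : ℝ => Ici x)
    (fun _ => measurableSet_Ici.nullMeasurableSet) (fun _ _ h => Ici_subset_Ici.2 h)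
    ⟨0, measure_ne_top _ _⟩
  have h' : (⋂ x : ℝ, Ici x) = ∅ := by
    ext y
    simp only [mem_iInter, mem_Ici, mem_empty_iff_false, iff_false, not_forall, not_le]
    exact exists_gt y
  rw [h', measure_empty] at h
  exact (ENNReal.tendsto_toReal ENNReal.zero_ne_top).comp h

lemma bddAbove_quantileSet {q : ℝ} (hq : 0 < q) : BddAbove {p | q ≤ acceptProb μ p} := by
  obtain ⟨N, hN⟩ := (tendsto_acceptProb_atTop (μ := μ)).eventually (gt_mem_nhds hq) |>.exists
  refine ⟨N, fun p hp => ?_⟩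
  by_contra! h
  exact absurd (hp.trans (acceptProb_antitone h.le)) (not_le.2 hN)

lemma zero_mem_quantileSet (h0 : μ (Iio 0) = 0) {q : ℝ} (hq : q ≤ 1) :
    (0 : ℝ) ∈ {p | q ≤ acceptProb μ p} := by
  simpa [acceptProb_of_nonpos h0 le_rfl] using hq

lemma le_quantilePrice {q p : ℝ} (hq : 0 < q) (hp : q ≤ acceptProb μ p) :
    p ≤ quantilePrice μ q :=
  le_csSup (bddAbove_quantileSet hq) hp

/-- The supremum defining the price is attained, by continuity of `μ` from above along closed
half-lines. -/
lemma le_acceptProb_quantilePrice (h0 : μ (Iio 0) = 0) {q : ℝ} (hq : 0 < q) (hq1 : q ≤ 1) :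
    q ≤ acceptProb μ (quantilePrice μ q) := by
  obtain ⟨u, hu, hlim, hmem⟩ := exists_seq_tendsto_sSup ⟨0, zero_mem_quantileSet h0 hq1⟩
    (bddAbove_quantileSet (μ := μ) hq)
  have hI : Ici (quantilePrice μ q) = ⋂ n, Ici (u n) := by
    ext y
    simp only [mem_iInter, mem_Ici]
    exact ⟨fun h n => (le_quantilePrice hq (hmem n)).trans h, fun h => le_of_tendsto' hlim h⟩
  have hm : ENNReal.ofReal q ≤ μ (Ici (quantilePrice μ q)) := by
    rw [hI, Antitone.measure_iInter (fun _ _ h => Ici_subset_Ici.2 (hu h))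
      (fun _ => measurableSet_Ici.nullMeasurableSet) ⟨0, measure_ne_top _ _⟩]
    refine le_iInf fun n => ?_
    rw [← ofReal_acceptProb]
    exact ENNReal.ofReal_le_ofReal (hmem n)
  exact (ENNReal.ofReal_le_iff_le_toReal (measure_ne_top _ _)).1 hm

lemma acceptProb_lt_of_quantilePrice_lt {q p : ℝ} (hq : 0 < q) (hp : quantilePrice μ q < p) :
    acceptProb μ p < q := by
  by_contra! h
  exact absurd (le_quantilePrice hq h) (not_le.2 hp)

lemma measure_Ioi_quantilePrice_le {q : ℝ} (hq : 0 < q) :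
    μ (Ioi (quantilePrice μ q)) ≤ ENNReal.ofReal q := by
  have hU : Ioi (quantilePrice μ q) = ⋃ n : ℕ, Ici (quantilePrice μ q + 1 / ((n : ℝ) + 1)) := by
    ext y
    simp only [mem_Ioi, mem_iUnion, mem_Ici]
    constructor
    · intro h
      obtain ⟨n, hn⟩ := exists_nat_one_div_lt (sub_pos.2 h)
      exact ⟨n, by linarith⟩
    · rintro ⟨n, hn⟩
      have : 0 < 1 / ((n : ℝ) + 1) := by positivity
      linarith
  have hmono : Monotone fun n : ℕ => Ici (quantilePrice μ q + 1 / ((n : ℝ) + 1)) := by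
    intro a b hab
    apply Ici_subset_Ici.2
    gcongr
  rw [hU, hmono.measure_iUnion]
  refine iSup_le fun n => ?_
  rw [← ofReal_acceptProb]
  refine ENNReal.ofReal_le_ofReal (acceptProb_lt_of_quantilePrice_lt hq ?_).le
  have : 0 < 1 / ((n : ℝ) + 1) := by positivity
  linarith

lemma quantilePrice_zero {μ : Measure ℝ} : quantilePrice μ 0 = 0 := by
  have : {p | (0 : ℝ) ≤ acceptProb μ p} = univ := eq_univ_of_forall fun p => acceptProb_nonneg p
  -- The default value of an unbounded supremum is `0`, which is the convention for agents with `q =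
  -- 0`.
  rw [quantilePrice, this, Real.sSup_univ]

lemma quantilePrice_nonneg (h0 : μ (Iio 0) = 0) {q : ℝ} (hq : q ∈ Icc (0 : ℝ) 1) :
    0 ≤ quantilePrice μ q := by
  rcases hq.1.eq_or_lt with rfl | h
  · rw [quantilePrice_zero]
  · exact le_quantilePrice h (zero_mem_quantileSet h0 hq.2)

lemma revenueCurve_nonneg (h0 : μ (Iio 0) = 0) {q : ℝ} (hq : q ∈ Icc (0 : ℝ) 1) :
    0 ≤ revenueCurve μ q :=
  mul_nonneg hq.1 (quantilePrice_nonneg h0 hq)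

end Quantile

/-! ### Resampling a coordinate -/

section Resample

variable {n : ℕ} {α : Type*} [MeasurableSpace α] (κ : Fin n → Measure α)
  [∀ i, IsProbabilityMeasure (κ i)]

lemma measurable_update_prod (i : Fin n) :
    Measurable fun p : (Fin n → α) × α => Function.update p.1 i p.2 := by
  refine measurable_pi_lambda _ fun j => ?_
  by_cases h : j = i
  · subst h
    simpa using measurable_snd
  · simp only [Function.update_of_ne h]
    exact (measurable_pi_apply j).comp measurable_fst

/-- Replacing one coordinate by an independent copy preserves a product law. This expresses
conditioning on the other coordinates without splitting the index type. -/
lemma measurePreserving_resample (i : Fin n) :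
    MeasurePreserving (fun p : (Fin n → α) × α => Function.update p.1 i p.2)
      ((Measure.pi κ).prod (κ i)) (Measure.pi κ) := by
  refine ⟨measurable_update_prod i, (Measure.pi_eq fun s hs => ?_).symm⟩
  rw [Measure.map_apply (measurable_update_prod i) (MeasurableSet.univ_pi hs)]
  have : (fun p : (Fin n → α) × α => Function.update p.1 i p.2) ⁻¹' (univ.pi s) =
      (univ.pi (Function.update s i univ)) ×ˢ s i := by
    ext p
    simp only [mem_preimage, mem_univ_pi, mem_prod]
    constructor
    · intro h
      refine ⟨fun j => ?_, by simpa using h i⟩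
      by_cases hj : j = i
      · subst hj; simp
      · simpa [Function.update_of_ne hj] using h j
    · rintro ⟨h, h'⟩ j
      by_cases hj : j = i
      · subst hj; simpa using h'
      · simpa [Function.update_of_ne hj] using h j
  rw [this, Measure.prod_prod, Measure.pi_pi, ← Finset.mul_prod_erase _ _ (Finset.mem_univ i),
    ← Finset.mul_prod_erase _ (fun j => κ j (s j)) (Finset.mem_univ i)]
  simp only [Function.update_self, measure_univ, one_mul]
  rw [mul_comm]
  congr 1
  refine Finset.prod_congr rfl fun j hj => ?_
  rw [Function.update_of_ne (Finset.ne_of_mem_erase hj)]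

lemma lintegral_resample (i : Fin n) {f : (Fin n → α) → ℝ≥0∞} (hf : Measurable f) :
    ∫⁻ w, f w ∂Measure.pi κ =
      ∫⁻ w, ∫⁻ z, f (Function.update w i z) ∂κ i ∂Measure.pi κ := by
  rw [← (measurePreserving_resample κ i).lintegral_comp hf,
    lintegral_prod (fun p : (Fin n → α) × α => f (Function.update p.1 i p.2))
      (hf.comp (measurable_update_prod i)).aemeasurable]

end Resample

/-! ### The greedy set in a partition matroid -/

section Greedy

variable {n : ℕ} {J : Set (Finset (Fin n))} {acc : Fin n → Prop}

open Classical in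
lemma servedSet_append_singleton (l : List (Fin n)) (i : Fin n) :
    servedSet J acc (l ++ [i]) =
      if insert i (servedSet J acc l) ∈ J ∧ acc i then insert i (servedSet J acc l)
      else servedSet J acc l := by
  rw [servedSet, List.foldl_append]
  rfl

lemma mem_of_mem_servedSet {l : List (Fin n)} {m : Fin n} (h : m ∈ servedSet J acc l) :
    m ∈ l ∧ acc m := by
  induction l using List.reverseRecOn with
  | nil => simp [servedSet] at h
  | append_singleton l i ih =>
    rw [servedSet_append_singleton] at h
    split_ifs at h with hi
    · rcases Finset.mem_insert.1 h with rfl | h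
      · simp [hi.2]
      · simp [ih h]
    · simp [ih h]

lemma servedSet_congr {acc' : Fin n → Prop} {l : List (Fin n)} (h : ∀ i ∈ l, acc i ↔ acc' i) :
    servedSet J acc l = servedSet J acc' l := by
  induction l using List.reverseRecOn with
  | nil => simp [servedSet]
  | append_singleton l i ih =>
    rw [servedSet_append_singleton, servedSet_append_singleton,
      ih fun j hj => h j (by simp [hj])]
    have hi : acc i = acc' i := propext (h i (by simp))
    rw [hi]

open Classical in
lemma sum_servedSet_append_singleton {β : Type*} [AddCommMonoid β] {l : List (Fin n)} {i : Fin n}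
    (hi : i ∉ l) (f : Fin n → β) :
    ∑ m ∈ servedSet J acc (l ++ [i]), f m = ∑ m ∈ servedSet J acc l, f m +
      if insert i (servedSet J acc l) ∈ J ∧ acc i then f i else 0 := by
  rw [servedSet_append_singleton]
  split_ifs
  · rw [Finset.sum_insert fun h => hi (mem_of_mem_servedSet h).1, add_comm]
  · simp

open Classical in
-- Greedy turns an agent away only when her block is full, so the number served in a block depends
-- on the accepting agents but not on the order.
lemma card_filter_servedSet {block : Fin n → ℕ} {cap : ℕ → ℕ}
    (hJ : ∀ S : Finset (Fin n), S ∈ J ↔ ∀ j, (S.filter (fun i => block i = j)).card ≤ cap j)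
    {l : List (Fin n)} (hl : l.Nodup) (j : ℕ) :
    ((servedSet J acc l).filter (fun i => block i = j)).card =
      min (cap j) ((l.toFinset.filter (fun i => block i = j)).filter acc).card := by
  induction l using List.reverseRecOn generalizing j with
  | nil => simp [servedSet]
  | append_singleton l i ih =>
    have hl' : l.Nodup := (List.nodup_append.1 hl).1
    have hil : i ∉ l := by
      intro h
      exact (List.nodup_append.1 hl).2.2 i h i (by simp) rfl
    replace ih := ih hl'
    have hiS : i ∉ servedSet J acc l := fun h => hil (mem_of_mem_servedSet h).1
    have hins : ∀ j, ((insert i (servedSet J acc l)).filter (fun i => block i = j)).card =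
        ((servedSet J acc l).filter (fun i => block i = j)).card + if block i = j then 1 else 0 := by
      intro j
      rw [Finset.filter_insert]
      split_ifs with h
      · rw [Finset.card_insert_of_notMem (by simp [hiS])]
      · rfl
    have hins' : (((l ++ [i]).toFinset.filter (fun i => block i = j)).filter acc).card =
        ((l.toFinset.filter (fun i => block i = j)).filter acc).card +
          if block i = j ∧ acc i then 1 else 0 := by
      have : (l ++ [i]).toFinset = insert i l.toFinset := by
        ext; simp
      rw [this, Finset.filter_insert]
      by_cases h : block i = j
      · by_cases h' : acc i
        · rw [if_pos h, Finset.filter_insert, if_pos h', Finset.card_insert_of_notMem (by simp [hil]),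
            if_pos ⟨h, h'⟩]
        · rw [if_pos h, Finset.filter_insert, if_neg h', if_neg (by tauto), add_zero]
      · rw [if_neg h, if_neg (by tauto), add_zero]
    have hfeas : insert i (servedSet J acc l) ∈ J ↔
        ((l.toFinset.filter (fun m => block m = block i)).filter acc).card < cap (block i) := by
      rw [hJ]
      constructor
      · intro h
        have := h (block i)
        rw [hins, ih, if_pos rfl] at this
        omega
      · intro h j
        rw [hins, ih]
        split_ifs with hj
        · subst hj; omega
        · simp
    rw [servedSet_append_singleton, hins']
    by_cases h : insert i (servedSet J acc l) ∈ J ∧ acc i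
    · rw [if_pos h, hins, ih]
      have h1 := hfeas.1 h.1
      by_cases hj : block i = j
      · subst hj
        simp only [h.2, and_self, if_true]
        omega
      · simp [hj]
    · rw [if_neg h, ih]
      by_cases hj : block i = j
      · subst hj
        by_cases ha : acc i
        · have h1 : ¬ insert i (servedSet J acc l) ∈ J := fun h' => h ⟨h', ha⟩
          rw [hfeas] at h1
          simp only [ha, and_self, if_true]
          omega
        · simp [ha]
      · simp [hj]

end Greedy

/-! ### The correlation gap of truncated sums of independent indicators -/

/-- The concave function `1 - exp (-x)` lies above its chord on `[0, 1]`, taken at `x = s / k`. -/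
lemma one_sub_exp_mul_le {k s : ℝ} (hk : 0 < k) (hs : 0 ≤ s) (hsk : s ≤ k) :
    (1 - Real.exp (-1)) * s ≤ k * (1 - Real.exp (-(s / k))) := by
  have hx0 : 0 ≤ s / k := by positivity
  have hx1 : s / k ≤ 1 := (div_le_one hk).2 hsk
  have h := convexOn_exp.2 (mem_univ (0 : ℝ)) (mem_univ (-1 : ℝ)) (sub_nonneg.2 hx1) hx0 (by ring)
  simp only [smul_eq_mul, mul_zero, zero_add, Real.exp_zero, mul_one, mul_neg] at h
  have : s = k * (s / k) := by field_simp
  calc (1 - Real.exp (-1)) * s = k * (s / k * (1 - Real.exp (-1))) := by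
        rw [this]; field_simp
    _ ≤ k * (1 - Real.exp (-(s / k))) := by
        refine mul_le_mul_of_nonneg_left ?_ hk.le
        linarith

/-- The left side is the expected number of occupied bins when `j` balls fall into `k` bins. Unlike
the minimum, it has an expectation that factorizes over independent indicators. -/
lemma mul_one_sub_pow_le_min {k : ℕ} (hk : 1 ≤ k) (j : ℕ) :
    (k : ℝ) * (1 - (1 - 1 / (k : ℝ)) ^ j) ≤ (min k j : ℕ) := by
  have hk' : (1 : ℝ) ≤ k := by exact_mod_cast hk
  have h1 : 1 / (k : ℝ) ≤ 1 := (div_le_one (by linarith)).2 hk'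
  push_cast
  refine le_min ?_ ?_
  · have : 0 ≤ (1 - 1 / (k : ℝ)) ^ j := pow_nonneg (by linarith) _
    nlinarith
  · have h := one_add_mul_le_pow (a := -(1 / (k : ℝ))) (by linarith) j
    rw [← sub_eq_add_neg] at h
    calc (k : ℝ) * (1 - (1 - 1 / (k : ℝ)) ^ j) ≤ k * (j * (1 / k)) := by
          refine mul_le_mul_of_nonneg_left ?_ (by linarith)
          linarith
      _ = j := by field_simp

section Pattern

variable {n : ℕ} {α : Type*} [MeasurableSpace α] {S : Set α}

lemma measurableSet_pattern (hS : MeasurableSet S) (Q : (Fin n → Prop) → Prop) :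
    MeasurableSet {w : Fin n → α | Q (fun i => w i ∈ S)} := by
  have h : Measurable fun (w : Fin n → α) (i : Fin n) => w i ∈ S :=
    measurable_pi_lambda _ fun i => measurableSet_setOfPred.1 (measurable_pi_apply i hS)
  exact h (Set.toFinite {x | Q x}).measurableSet

variable (κ : Fin n → Measure α) [∀ i, IsProbabilityMeasure (κ i)] {q : Fin n → ℝ}

open Classical in
lemma integral_pow_card (hS : MeasurableSet S) (hq : ∀ i, (κ i).real S = q i)
    (T : Finset (Fin n)) (a : ℝ) :
    ∫ w, (1 - a) ^ (T.filter (fun i => w i ∈ S)).card ∂Measure.pi κ = ∏ i ∈ T, (1 - a * q i) := by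
  have h := integral_fintype_prod_eq_prod (𝕜 := ℝ) (μ := κ)
    (fun i (z : α) => if i ∈ T then 1 - a * S.indicator 1 z else 1)
  have h1 : ∀ w : Fin n → α, (1 - a) ^ (T.filter (fun i => w i ∈ S)).card =
      ∏ i, (if i ∈ T then 1 - a * S.indicator 1 (w i) else 1) := by
    intro w
    rw [Finset.prod_ite_mem, Finset.univ_inter, Finset.card_filter, ← Finset.prod_pow_eq_pow_sum]
    refine Finset.prod_congr rfl fun i _ => ?_
    by_cases hi : w i ∈ S <;> simp [hi]
  have h2 : ∀ i, ∫ z, (if i ∈ T then 1 - a * S.indicator 1 z else 1) ∂κ i =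
      if i ∈ T then 1 - a * q i else 1 := by
    intro i
    by_cases hi : i ∈ T
    · simp only [hi, if_true]
      have hint : Integrable (S.indicator (1 : α → ℝ)) (κ i) :=
        (integrable_const (1 : ℝ)).indicator hS
      rw [integral_sub (integrable_const _) (hint.const_mul a), integral_const_mul,
        integral_indicator_one hS, hq]
      simp
    · simp [hi]
  simp_rw [h1, h, h2]
  rw [Finset.prod_ite_mem, Finset.univ_inter]

open Classical in
lemma integrable_pattern (hS : MeasurableSet S) (F : (Fin n → Prop) → ℝ) :
    Integrable (fun w : Fin n → α => F (fun i => w i ∈ S)) (Measure.pi κ) := by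
  have hm : Measurable (fun w : Fin n → α => F (fun i => w i ∈ S)) := by
    intro s _
    exact measurableSet_pattern hS fun x => F x ∈ s
  obtain ⟨C, hC⟩ := (Set.finite_range fun x => ‖F x‖).bddAbove
  exact Integrable.of_bound hm.aestronglyMeasurable C (ae_of_all _ fun w => hC ⟨_, rfl⟩)

open Classical in
-- Bounding the minimum below by the occupancy function turns the expectation into `∏ (1 - q i /
-- k)`; then `1 - x ≤ exp (-x)` and concavity finish.
lemma le_integral_min_card (hS : MeasurableSet S) (hq : ∀ i, (κ i).real S = q i)
    (T : Finset (Fin n)) (k : ℕ) (hT : ∑ i ∈ T, q i ≤ k) :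
    (1 - Real.exp (-1)) * ∑ i ∈ T, q i ≤
      ∫ w, ((min k (T.filter (fun i => w i ∈ S)).card : ℕ) : ℝ) ∂Measure.pi κ := by
  have hq0 : ∀ i, 0 ≤ q i := fun i => hq i ▸ measureReal_nonneg
  have hq1 : ∀ i, q i ≤ 1 := fun i => hq i ▸ measureReal_le_one
  have hs0 : 0 ≤ ∑ i ∈ T, q i := Finset.sum_nonneg fun i _ => hq0 i
  rcases Nat.eq_zero_or_pos k with rfl | hk
  · have : ∑ i ∈ T, q i = 0 := le_antisymm (by simpa using hT) hs0
    simp [this]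
  have hk' : (1 : ℝ) ≤ k := by exact_mod_cast hk
  have hk1 : 1 / (k : ℝ) ≤ 1 := (div_le_one (by linarith)).2 hk'
  have hprod : ∏ i ∈ T, (1 - 1 / (k : ℝ) * q i) ≤ Real.exp (-((∑ i ∈ T, q i) / k)) := by
    have : -((∑ i ∈ T, q i) / (k : ℝ)) = ∑ i ∈ T, -(1 / (k : ℝ) * q i) := by
      rw [Finset.sum_neg_distrib, ← Finset.mul_sum]; ring
    rw [this, Real.exp_sum]
    refine Finset.prod_le_prod (fun i _ => ?_) fun i _ => ?_
    · have : 1 / (k : ℝ) * q i ≤ 1 := mul_le_one₀ hk1 (hq0 i) (hq1 i)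
      linarith
    · have := Real.add_one_le_exp (-(1 / (k : ℝ) * q i))
      linarith
  calc (1 - Real.exp (-1)) * ∑ i ∈ T, q i
      ≤ k * (1 - Real.exp (-((∑ i ∈ T, q i) / k))) :=
        one_sub_exp_mul_le (by linarith) hs0 hT
    _ ≤ k * (1 - ∏ i ∈ T, (1 - 1 / (k : ℝ) * q i)) := by
        refine mul_le_mul_of_nonneg_left ?_ (by linarith)
        linarith
    _ = ∫ w, (k : ℝ) * (1 - (1 - 1 / (k : ℝ)) ^ (T.filter (fun i => w i ∈ S)).card)
          ∂Measure.pi κ := by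
        have hint := integrable_pattern κ hS
          fun x => (1 - 1 / (k : ℝ)) ^ (T.filter x).card
        rw [integral_const_mul, integral_sub (integrable_const _) hint,
          integral_pow_card κ hS hq]
        simp
    _ ≤ _ := by
        refine integral_mono
          (integrable_pattern κ hS fun x => (k : ℝ) * (1 - (1 - 1 / (k : ℝ)) ^ (T.filter x).card))
          (integrable_pattern κ hS fun x => ((min k (T.filter x).card : ℕ) : ℝ)) fun w => ?_
        exact mul_one_sub_pow_le_min hk _

/-! ### The greedy mechanism with independent acceptances -/

variable {J : Set (Finset (Fin n))}

lemma measurable_sum_servedSet (hS : MeasurableSet S) (l : List (Fin n)) {g : α → ℝ≥0∞}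
    (hg : Measurable g) :
    Measurable fun w : Fin n → α => ∑ m ∈ servedSet J (fun i => w i ∈ S) l, g (w m) := by
  have : (fun w : Fin n → α => ∑ m ∈ servedSet J (fun i => w i ∈ S) l, g (w m)) =
      fun w => ∑ m, {w : Fin n → α | m ∈ servedSet J (fun i => w i ∈ S) l}.indicator
        (fun w => g (w m)) w := by
    classical
    ext w
    simp [Set.indicator_apply, Finset.sum_ite_mem]
  rw [this]
  refine Finset.measurable_sum _ fun m _ => ?_
  exact (hg.comp (measurable_pi_apply m)).indicator
    (measurableSet_pattern hS fun x => m ∈ servedSet J x l)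

open Classical in
-- Whether `i` can still be added depends only on the agents before her, hence is independent of her
-- own value and offer, so her contribution is a product.
lemma lintegral_sum_servedSet_append (hS : MeasurableSet S) {l : List (Fin n)} {i : Fin n}
    (hi : i ∉ l) {g : α → ℝ≥0∞} (hg : Measurable g) :
    ∫⁻ w, ∑ m ∈ servedSet J (fun i => w i ∈ S) (l ++ [i]), g (w m) ∂Measure.pi κ =
      ∫⁻ w, ∑ m ∈ servedSet J (fun i => w i ∈ S) l, g (w m) ∂Measure.pi κ +
        Measure.pi κ {w | insert i (servedSet J (fun i => w i ∈ S) l) ∈ J} *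
          ∫⁻ z in S, g z ∂κ i := by
  set A : Set (Fin n → α) := {w | insert i (servedSet J (fun i => w i ∈ S) l) ∈ J} with hA
  have hAm : MeasurableSet A :=
    measurableSet_pattern hS fun x => insert i (servedSet J x l) ∈ J
  simp_rw [sum_servedSet_append_singleton hi]
  rw [lintegral_add_left (measurable_sum_servedSet hS l hg)]
  congr 1
  have h1 : ∀ w : Fin n → α,
      (if insert i (servedSet J (fun i => w i ∈ S) l) ∈ J ∧ w i ∈ S then g (w i) else 0) =
        A.indicator 1 w * S.indicator g (w i) := by
    intro w
    by_cases h : insert i (servedSet J (fun i => w i ∈ S) l) ∈ J <;> by_cases h' : w i ∈ S <;>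
      simp [hA, h, h']
  simp_rw [h1]
  have hSg : Measurable (S.indicator g) := hg.indicator hS
  rw [lintegral_resample κ i (f := fun w => A.indicator 1 w * S.indicator g (w i))
    ((measurable_one.indicator hAm).mul (hSg.comp (measurable_pi_apply i)))]
  have h2 : ∀ (w : Fin n → α) (z : α), A.indicator (1 : (Fin n → α) → ℝ≥0∞) (Function.update w i z) =
      A.indicator 1 w := by
    intro w z
    have : Function.update w i z ∈ A ↔ w ∈ A := by
      simp only [hA, mem_ofPred_eq]
      rw [servedSet_congr (acc' := fun i => w i ∈ S)]
      intro j hj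
      rw [Function.update_of_ne (by rintro rfl; exact hi hj)]
    by_cases h : w ∈ A
    · simp [h, this.2 h]
    · rw [indicator_of_notMem h, indicator_of_notMem (mt this.1 h)]
  simp_rw [h2, Function.update_self]
  simp_rw [lintegral_const_mul _ hSg]
  rw [lintegral_mul_const _ (measurable_one.indicator hAm), lintegral_indicator_one hAm,
    lintegral_indicator hS]

open Classical in
/-- The expected number of agents served is at least a `1 - 1 / e` fraction of the ex ante bound. -/
lemma le_lintegral_card_servedSet {block : Fin n → ℕ} {cap : ℕ → ℕ}
    (hJ : ∀ S : Finset (Fin n), S ∈ J ↔ ∀ j, (S.filter (fun i => block i = j)).card ≤ cap j)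
    (hS : MeasurableSet S) (hq : ∀ i, (κ i).real S = q i)
    (hcap : ∀ j, ∑ i with block i = j, q i ≤ cap j) {l : List (Fin n)} (hl : l.Nodup) :
    ENNReal.ofReal ((1 - Real.exp (-1)) * ∑ i ∈ l.toFinset, q i) ≤
      ∫⁻ w, ∑ _m ∈ servedSet J (fun i => w i ∈ S) l, 1 ∂Measure.pi κ := by
  have hq0 : ∀ i, 0 ≤ q i := fun i => hq i ▸ measureReal_nonneg
  set F : (Fin n → Prop) → ℕ → ℝ := fun x j =>
    ((min (cap j) ((l.toFinset.filter (fun i => block i = j)).filter x).card : ℕ) : ℝ) with hF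
  have hcard : ∀ w : Fin n → α, ∑ _m ∈ servedSet J (fun i => w i ∈ S) l, (1 : ℝ≥0∞) =
      ENNReal.ofReal (∑ j ∈ Finset.univ.image block, F (fun i => w i ∈ S) j) := by
    intro w
    have h1 := Finset.card_eq_sum_card_fiberwise (f := block)
      (s := servedSet J (fun i => w i ∈ S) l) (t := Finset.univ.image block) (by intro; simp)
    simp_rw [card_filter_servedSet hJ hl] at h1
    rw [Finset.sum_const, nsmul_eq_mul, mul_one, h1, hF, ← Nat.cast_sum, ENNReal.ofReal_natCast]
  simp_rw [hcard]
  have hint : ∀ j ∈ Finset.univ.image block,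
      Integrable (fun w : Fin n → α => F (fun i => w i ∈ S) j) (Measure.pi κ) :=
    fun j _ => integrable_pattern κ hS fun x => F x j
  rw [← ofReal_integral_eq_lintegral_ofReal (integrable_finsetSum _ hint)
    (ae_of_all _ fun w => Finset.sum_nonneg fun j _ => Nat.cast_nonneg _),
    integral_finsetSum _ hint]
  refine ENNReal.ofReal_le_ofReal ?_
  rw [← Finset.sum_fiberwise_of_maps_to (s := l.toFinset) (t := Finset.univ.image block)
    (g := block) (by intro; simp), Finset.mul_sum]
  refine Finset.sum_le_sum fun j _ => le_integral_min_card κ hS hq _ _ ((hcap j).trans' ?_)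
  refine Finset.sum_le_sum_of_subset_of_nonneg ?_ fun i _ _ => hq0 i
  exact Finset.filter_subset_filter _ (Finset.subset_univ _)

open Classical in
-- Summation by parts as an induction: the revenue surplus of a prefix over its target is at least
-- `ρ` times its quantity surplus, for every `ρ` below all rates `r i` of the prefix. Real `E` and
-- `N` are extracted so that surpluses can be subtracted.
lemma exists_revenue_lower_bound {block : Fin n → ℕ} {cap : ℕ → ℕ}
    (hJ : ∀ S : Finset (Fin n), S ∈ J ↔ ∀ j, (S.filter (fun i => block i = j)).card ≤ cap j)
    (hS : MeasurableSet S) (hq : ∀ i, (κ i).real S = q i)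
    (hcap : ∀ j, ∑ i with block i = j, q i ≤ cap j) {g : α → ℝ≥0∞} (hg : Measurable g)
    {r : Fin n → ℝ} (hr : ∀ i, 0 ≤ r i)
    (hgr : ∀ i, ∫⁻ z in S, g z ∂κ i = ENNReal.ofReal (r i * q i))
    {l : List (Fin n)} (hl : l.Nodup) (hlr : l.Pairwise fun i j => r j ≤ r i) :
    ∃ E N : ℝ, 0 ≤ E ∧ 0 ≤ N ∧
      ∫⁻ w, ∑ m ∈ servedSet J (fun i => w i ∈ S) l, g (w m) ∂Measure.pi κ = ENNReal.ofReal E ∧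
      ∫⁻ w, ∑ _m ∈ servedSet J (fun i => w i ∈ S) l, 1 ∂Measure.pi κ = ENNReal.ofReal N ∧
      ∀ ρ, 0 ≤ ρ → (∀ i ∈ l, ρ ≤ r i) →
        ρ * (N - (1 - Real.exp (-1)) * ∑ i ∈ l.toFinset, q i) ≤
          E - (1 - Real.exp (-1)) * ∑ i ∈ l.toFinset, r i * q i := by
  have hq0 : ∀ i, 0 ≤ q i := fun i => hq i ▸ measureReal_nonneg
  induction l using List.reverseRecOn with
  | nil => exact ⟨0, 0, le_rfl, le_rfl, by simp [servedSet], by simp [servedSet], by simp⟩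
  | append_singleton l i ih =>
    have hl' : l.Nodup := (List.nodup_append.1 hl).1
    have hil : i ∉ l := fun h => (List.nodup_append.1 hl).2.2 i h i (by simp) rfl
    rw [List.pairwise_append] at hlr
    obtain ⟨E, N, hE, hN, hEl, hNl, h⟩ := ih hl' hlr.1
    set P := (Measure.pi κ).real {w | insert i (servedSet J (fun i => w i ∈ S) l) ∈ J} with hP
    have hP0 : 0 ≤ P := measureReal_nonneg
    have hPe : Measure.pi κ {w | insert i (servedSet J (fun i => w i ∈ S) l) ∈ J} =
        ENNReal.ofReal P := by rw [hP, ofReal_measureReal]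
    have hone : ∫⁻ _z in S, (1 : ℝ≥0∞) ∂κ i = ENNReal.ofReal (q i) := by
      rw [setLIntegral_one, ← hq i, ofReal_measureReal]
    have hrq : 0 ≤ r i * q i := mul_nonneg (hr i) (hq0 i)
    have hNe : ∫⁻ w, ∑ _m ∈ servedSet J (fun i => w i ∈ S) (l ++ [i]), 1 ∂Measure.pi κ =
        ENNReal.ofReal (N + P * q i) := by
      rw [lintegral_sum_servedSet_append κ hS hil (g := fun _ => 1) measurable_const, hNl, hPe,
        hone, ← ENNReal.ofReal_mul hP0, ← ENNReal.ofReal_add hN (mul_nonneg hP0 (hq0 i))]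
    have hsum : ∀ f : Fin n → ℝ, ∑ m ∈ (l ++ [i]).toFinset, f m = ∑ m ∈ l.toFinset, f m + f i := by
      intro f
      have : (l ++ [i]).toFinset = insert i l.toFinset := by ext; simp
      rw [this, Finset.sum_insert (by simpa using hil), add_comm]
    refine ⟨E + P * (r i * q i), N + P * q i, by positivity, ?_, ?_, hNe, fun ρ hρ hρl => ?_⟩
    · exact add_nonneg hN (mul_nonneg hP0 (hq0 i))
    · rw [lintegral_sum_servedSet_append κ hS hil hg, hEl, hPe, hgr,
        ← ENNReal.ofReal_mul hP0, ← ENNReal.ofReal_add hE (mul_nonneg hP0 hrq)]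
    · have hD : (1 - Real.exp (-1)) * ∑ m ∈ (l ++ [i]).toFinset, q m ≤ N + P * q i := by
        have := le_lintegral_card_servedSet κ hJ hS hq hcap hl
        rw [hNe] at this
        exact (ENNReal.ofReal_le_ofReal_iff
          (add_nonneg hN (mul_nonneg hP0 (hq0 i)))).1 this
      -- At the rate `r i` of the last and cheapest agent, the extended prefix has revenue surplus
      -- at least `r i` times its quantity surplus. The latter is nonnegative by `hD`, so `r i` may
      -- be lowered to `ρ`.
      have hi := h (r i) (hr i) fun j hj => hlr.2.2 j hj i (by simp)
      have hρi := hρl i (by simp)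
      have := mul_le_mul_of_nonneg_right hρi (sub_nonneg.2 hD)
      rw [hsum] at this ⊢
      rw [hsum]
      linarith

end Pattern

/-! ### Random offers -/

section Offer

variable {μ : Measure ℝ} [IsProbabilityMeasure μ]

/-- Pairs of a value and a price such that the price is accepted. -/
def acceptSet : Set (ℝ × EReal) := {z | z.2 ≤ (z.1 : EReal)}

lemma measurableSet_acceptSet : MeasurableSet acceptSet :=
  measurableSet_le measurable_snd (measurable_coe_real_ereal.comp measurable_fst)

lemma setLIntegral_acceptSet (ν : Measure EReal) [SFinite ν] {h : EReal → ℝ≥0∞}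
    (hh : Measurable h) :
    ∫⁻ z in acceptSet, h z.2 ∂(μ.prod ν) = ∫⁻ y, h y * μ {x | y ≤ (x : EReal)} ∂ν := by
  rw [← lintegral_indicator measurableSet_acceptSet, lintegral_prod_symm]
  · refine lintegral_congr fun y => ?_
    have hm : MeasurableSet {x : ℝ | y ≤ (x : EReal)} :=
      measurableSet_le measurable_const measurable_coe_real_ereal
    rw [← lintegral_indicator_const hm]
    rfl
  · exact ((hh.comp measurable_snd).indicator measurableSet_acceptSet).aemeasurable

/-- The weight `q / P(V ≥ p)` times the acceptance probability of `p` is `q`, and the price `⊤` is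
never accepted. -/
lemma lintegral_quantileOffer (h0 : μ (Iio 0) = 0) {q : ℝ} (hq : q ∈ Icc (0 : ℝ) 1)
    (h : EReal → ℝ≥0∞) :
    ∫⁻ y, h y * μ {x | y ≤ (x : EReal)} ∂(quantileOffer μ q) =
      ENNReal.ofReal q * h (quantilePrice μ q : EReal) := by
  simp only [quantileOffer, lintegral_add_measure, lintegral_smul_measure, lintegral_dirac,
    smul_eq_mul]
  have h1 : {x : ℝ | (⊤ : EReal) ≤ (x : EReal)} = ∅ := by ext x; simp
  have h2 : {x : ℝ | (quantilePrice μ q : EReal) ≤ (x : EReal)} = Ici (quantilePrice μ q) := by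
    ext x; simp
  rw [h1, h2, measure_empty, mul_zero, mul_zero, add_zero, mul_left_comm, ← ofReal_acceptProb,
    ← ENNReal.ofReal_mul (div_nonneg hq.1 (acceptProb_nonneg _)), mul_comm]
  rcases hq.1.eq_or_lt with rfl | hq0
  · simp
  · rw [div_mul_cancel₀ _ (hq0.trans_le (le_acceptProb_quantilePrice h0 hq0 hq.2)).ne']

lemma isProbabilityMeasure_quantileOffer (h0 : μ (Iio 0) = 0) {q : ℝ} (hq : q ∈ Icc (0 : ℝ) 1) :
    IsProbabilityMeasure (quantileOffer μ q) := by
  constructor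
  have h1 : q / acceptProb μ (quantilePrice μ q) ≤ 1 := by
    rcases hq.1.eq_or_lt with rfl | hq0
    · simp
    · have := le_acceptProb_quantilePrice h0 hq0 hq.2
      exact (div_le_one (hq0.trans_le this)).2 this
  have h2 : 0 ≤ q / acceptProb μ (quantilePrice μ q) := div_nonneg hq.1 (acceptProb_nonneg _)
  simp only [quantileOffer, Measure.add_apply, Measure.smul_apply, measure_univ, smul_eq_mul,
    mul_one]
  rw [← ENNReal.ofReal_add h2 (sub_nonneg.2 h1)]
  simp

/-- The parameters of the lottery are probabilities and it sells with total probability `q`. -/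
structure Lottery.IsValid (L : Lottery) (q : ℝ) : Prop where
  x_mem : L.x ∈ Icc (0 : ℝ) 1
  lo_mem : L.lo ∈ Icc (0 : ℝ) 1
  hi_mem : L.hi ∈ Icc (0 : ℝ) 1
  prob_eq : L.x * L.lo + (1 - L.x) * L.hi = q

lemma Lottery.IsOptimal.isValid {μ : Measure ℝ} {L : Lottery} {q : ℝ}
    (hL : L.IsOptimal μ q) : L.IsValid q :=
  ⟨hL.x_mem, hL.lo_mem, hL.hi_mem, hL.prob_eq⟩

namespace Lottery.IsValid

variable {L : Lottery} {q : ℝ}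

lemma isProbabilityMeasure_offer (hL : L.IsValid q) (h0 : μ (Iio 0) = 0) :
    IsProbabilityMeasure (L.offer μ) := by
  have := isProbabilityMeasure_quantileOffer h0 hL.lo_mem
  have := isProbabilityMeasure_quantileOffer h0 hL.hi_mem
  constructor
  simp only [Lottery.offer, Measure.add_apply, Measure.smul_apply, measure_univ, smul_eq_mul,
    mul_one]
  rw [← ENNReal.ofReal_add hL.x_mem.1 (sub_nonneg.2 hL.x_mem.2)]
  simp

lemma lintegral_offer (hL : L.IsValid q) (h0 : μ (Iio 0) = 0) (h : EReal → ℝ≥0∞) :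
    ∫⁻ y, h y * μ {x | y ≤ (x : EReal)} ∂(L.offer μ) =
      ENNReal.ofReal L.x * (ENNReal.ofReal L.lo * h (quantilePrice μ L.lo : EReal)) +
      ENNReal.ofReal (1 - L.x) * (ENNReal.ofReal L.hi * h (quantilePrice μ L.hi : EReal)) := by
  rw [Lottery.offer, lintegral_add_measure, lintegral_smul_measure, lintegral_smul_measure,
    lintegral_quantileOffer h0 hL.lo_mem, lintegral_quantileOffer h0 hL.hi_mem, smul_eq_mul,
    smul_eq_mul]

lemma measure_acceptSet (hL : L.IsValid q) (h0 : μ (Iio 0) = 0) :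
    (μ.prod (L.offer μ)).real acceptSet = q := by
  have := hL.isProbabilityMeasure_offer h0
  have hx := sub_nonneg.2 hL.x_mem.2
  have h := setLIntegral_acceptSet (μ := μ) (L.offer μ) (h := fun _ => 1) measurable_const
  rw [hL.lintegral_offer h0 (fun _ => 1), setLIntegral_one, mul_one, mul_one,
    ← ENNReal.ofReal_mul hL.x_mem.1, ← ENNReal.ofReal_mul hx,
    ← ENNReal.ofReal_add (mul_nonneg hL.x_mem.1 hL.lo_mem.1) (mul_nonneg hx hL.hi_mem.1),
    hL.prob_eq] at h
  have hq : 0 ≤ q := by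
    rw [← hL.prob_eq]
    exact add_nonneg (mul_nonneg hL.x_mem.1 hL.lo_mem.1) (mul_nonneg hx hL.hi_mem.1)
  rw [measureReal_def, h, ENNReal.toReal_ofReal hq]

lemma setLIntegral_offer (hL : L.IsValid q) (h0 : μ (Iio 0) = 0) :
    ∫⁻ z in acceptSet, z.2.toENNReal ∂(μ.prod (L.offer μ)) = ENNReal.ofReal (L.value μ) := by
  have := hL.isProbabilityMeasure_offer h0
  have hx := sub_nonneg.2 hL.x_mem.2
  rw [setLIntegral_acceptSet (μ := μ) (L.offer μ) measurable_ereal_toENNReal,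
    hL.lintegral_offer h0, EReal.toENNReal_of_ne_top (EReal.coe_ne_top _),
    EReal.toENNReal_of_ne_top (EReal.coe_ne_top _), EReal.toReal_coe, EReal.toReal_coe,
    ← ENNReal.ofReal_mul hL.lo_mem.1, ← ENNReal.ofReal_mul hL.hi_mem.1,
    ← ENNReal.ofReal_mul hL.x_mem.1, ← ENNReal.ofReal_mul hx, ← ENNReal.ofReal_add]
  · rfl
  · exact mul_nonneg hL.x_mem.1 (revenueCurve_nonneg h0 hL.lo_mem)
  · exact mul_nonneg hx (revenueCurve_nonneg h0 hL.hi_mem)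

lemma value_nonneg (hL : L.IsValid q) (h0 : μ (Iio 0) = 0) : 0 ≤ L.value μ :=
  add_nonneg (mul_nonneg hL.x_mem.1 (revenueCurve_nonneg h0 hL.lo_mem))
    (mul_nonneg (sub_nonneg.2 hL.x_mem.2) (revenueCurve_nonneg h0 hL.hi_mem))

lemma value_eq_zero {μ : Measure ℝ} (hL : L.IsValid 0) : L.value μ = 0 := by
  have h1 := mul_nonneg hL.x_mem.1 hL.lo_mem.1
  have h2 := mul_nonneg (sub_nonneg.2 hL.x_mem.2) hL.hi_mem.1
  have h := hL.prob_eq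
  have h3 : L.x * L.lo = 0 := by linarith
  have h4 : (1 - L.x) * L.hi = 0 := by linarith
  simp only [Lottery.value, revenueCurve]
  rw [← mul_assoc, h3, ← mul_assoc, h4]
  simp

end Lottery.IsValid

end Offer

/-! ### The revenue of sequential posted-price mechanisms -/

/-- The ratio `value / q` is the expected price given acceptance, so it serves as the rate in the
greedy bound. -/
theorem ofReal_sum_value_le_spmRevenue {n : ℕ} (I : BSMD n) {block : Fin n → ℕ} {cap : ℕ → ℕ}
    (hJ : ∀ S : Finset (Fin n),
      S ∈ I.feasible ↔ ∀ j, (S.filter (fun i => block i = j)).card ≤ cap j)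
    {q : Fin n → ℝ} (hcap : ∀ j, ∑ i with block i = j, q i ≤ cap j)
    {L : Fin n → Lottery} (hL : ∀ i, (L i).IsValid (q i)) {σ : Equiv.Perm (Fin n)}
    (hσ : Antitone fun k => (L (σ k)).value (I.dist (σ k)) / q (σ k)) :
    ENNReal.ofReal (∑ i, (L i).value (I.dist i)) ≤
      ENNReal.ofReal (Real.exp 1 / (Real.exp 1 - 1)) *
        I.spmRevenue σ (fun i => (L i).offer (I.dist i)) := by
  have := fun i => (hL i).isProbabilityMeasure_offer (I.nonneg i)
  have hq : ∀ i, ((I.dist i).prod ((L i).offer (I.dist i))).real acceptSet = q i :=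
    fun i => (hL i).measure_acceptSet (I.nonneg i)
  have hq0 : ∀ i, 0 ≤ q i := fun i => hq i ▸ measureReal_nonneg
  -- Division by zero is harmless: a lottery that never sells has value `0`.
  have hv : ∀ i, (L i).value (I.dist i) = (L i).value (I.dist i) / q i * q i := by
    intro i
    by_cases h : q i = 0
    · rw [h, mul_zero]
      exact Lottery.IsValid.value_eq_zero (h ▸ hL i)
    · rw [div_mul_cancel₀ _ h]
  obtain ⟨E, N, hE, -, hEl, -, h⟩ := exists_revenue_lower_bound
    (fun i => (I.dist i).prod ((L i).offer (I.dist i))) hJ measurableSet_acceptSet hq hcap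
    (g := fun z => z.2.toENNReal) (measurable_ereal_toENNReal.comp measurable_snd)
    (r := fun i => (L i).value (I.dist i) / q i)
    (fun i => div_nonneg ((hL i).value_nonneg (I.nonneg i)) (hq0 i))
    (fun i => by rw [← hv]; exact (hL i).setLIntegral_offer (I.nonneg i))
    (l := List.ofFn σ) (List.nodup_ofFn.2 σ.injective)
    (List.pairwise_ofFn.2 fun a b hab => hσ hab.le)
  have hE' : I.spmRevenue σ (fun i => (L i).offer (I.dist i)) = ENNReal.ofReal E := hEl
  have huniv : (List.ofFn σ).toFinset = Finset.univ := by
    ext i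
    simpa [List.mem_ofFn] using σ.surjective i
  -- Taking `ρ = 0` discards the quantity surplus.
  have h := h 0 le_rfl fun i _ => div_nonneg ((hL i).value_nonneg (I.nonneg i)) (hq0 i)
  simp only [← hv, huniv, zero_mul] at h
  have he : 1 < Real.exp 1 := Real.one_lt_exp_iff.2 one_pos
  have hc : 0 ≤ Real.exp 1 / (Real.exp 1 - 1) := div_nonneg (by linarith) (by linarith)
  rw [hE', ← ENNReal.ofReal_mul hc]
  refine ENNReal.ofReal_le_ofReal ?_
  have hinv : Real.exp 1 / (Real.exp 1 - 1) * (1 - Real.exp (-1)) = 1 := by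
    rw [Real.exp_neg]
    field_simp [sub_ne_zero.2 he.ne']
  calc ∑ i, (L i).value (I.dist i)
      = Real.exp 1 / (Real.exp 1 - 1) * ((1 - Real.exp (-1)) * ∑ i, (L i).value (I.dist i)) := by
        rw [← mul_assoc, hinv, one_mul]
    _ ≤ _ := mul_le_mul_of_nonneg_left (by linarith) hc

/-! ### The revenue of truthful mechanisms -/

instance {n : ℕ} (I : BSMD n) : IsProbabilityMeasure I.law :=
  inferInstanceAs (IsProbabilityMeasure (Measure.pi I.dist))

lemma BSMD.ae_dist_nonneg {n : ℕ} (I : BSMD n) (i : Fin n) : ∀ᵐ z ∂I.dist i, 0 ≤ z := by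
  rw [ae_iff]
  simp only [not_le]
  exact I.nonneg i

lemma BSMD.ae_nonneg {n : ℕ} (I : BSMD n) : ∀ᵐ v ∂I.law, 0 ≤ v := by
  have h : ∀ i, ∀ᵐ v ∂I.law, 0 ≤ v i := fun i =>
    (measurePreserving_eval I.dist i).quasiMeasurePreserving.ae (I.ae_dist_nonneg i)
  filter_upwards [ae_all_iff.2 h] with v hv using hv

namespace Mechanism

variable {n : ℕ} {I : BSMD n} (M : Mechanism I)

lemma serveProb_mem (i : Fin n) : M.serveProb i ∈ Icc (0 : ℝ) 1 :=
  ⟨measureReal_nonneg, measureReal_le_one⟩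

open Classical in
-- The capacity constraint holds pointwise, hence in expectation.
lemma sum_serveProb_le {block : Fin n → ℕ} {cap : ℕ → ℕ}
    (hJ : ∀ S : Finset (Fin n),
      S ∈ I.feasible ↔ ∀ j, (S.filter (fun i => block i = j)).card ≤ cap j) (j : ℕ) :
    ∑ i with block i = j, M.serveProb i ≤ cap j := by
  have hint : ∀ i, Integrable ({v | i ∈ M.alloc v}.indicator (1 : (Fin n → ℝ) → ℝ)) I.law :=
    fun i => (integrable_const (1 : ℝ)).indicator (M.measurable_alloc i)
  have h1 : ∀ i, M.serveProb i = ∫ v, {v | i ∈ M.alloc v}.indicator 1 v ∂I.law := fun i => by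
    rw [integral_indicator_one (M.measurable_alloc i)]; rfl
  simp_rw [h1]
  rw [← integral_finsetSum _ fun i _ => hint i]
  calc _ ≤ ∫ _v, (cap j : ℝ) ∂I.law := by
        refine integral_mono (integrable_finsetSum _ fun i _ => hint i) (integrable_const _)
          fun v => ?_
        have := (hJ _).1 (M.alloc_mem v) j
        have h2 : ∑ i with block i = j, {v | i ∈ M.alloc v}.indicator (1 : (Fin n → ℝ) → ℝ) v =
            ((M.alloc v).filter (fun i => block i = j)).card := by
          simp only [indicator_apply, mem_ofPred_eq, Pi.one_apply]
          rw [Finset.sum_boole, Finset.filter_filter]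
          congr 2
          ext i
          simp [and_comm]
        simp only [h2]
        exact_mod_cast this
    _ = cap j := by simp

/-- The probability over the value of agent `i` that she is served, given the other values. -/
def condServeProb (i : Fin n) (v : Fin n → ℝ) : ℝ :=
  (I.dist i).real {z | i ∈ M.alloc (Function.update v i z)}

lemma condServeProb_mem (i : Fin n) (v : Fin n → ℝ) : M.condServeProb i v ∈ Icc (0 : ℝ) 1 :=
  ⟨measureReal_nonneg, measureReal_le_one⟩

lemma measurable_condServeProb (i : Fin n) : Measurable (M.condServeProb i) :=
  (measurable_measure_prodMk_left (ν := I.dist i)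
    (measurable_update_prod i (M.measurable_alloc i))).ennreal_toReal

lemma integrable_condServeProb (i : Fin n) : Integrable (M.condServeProb i) I.law :=
  Integrable.of_bound (M.measurable_condServeProb i).aestronglyMeasurable 1 <| ae_of_all _ fun v => by
    rw [Real.norm_of_nonneg (M.condServeProb_mem i v).1]
    exact (M.condServeProb_mem i v).2

lemma integral_condServeProb (i : Fin n) :
    ∫ v, M.condServeProb i v ∂I.law = M.serveProb i := by
  have h := lintegral_resample I.dist i (f := {v | i ∈ M.alloc v}.indicator 1)
    (measurable_one.indicator (M.measurable_alloc i))
  rw [lintegral_indicator_one (M.measurable_alloc i)] at h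
  have h2 : ∀ v : Fin n → ℝ, ∫⁻ z, {v | i ∈ M.alloc v}.indicator (1 : (Fin n → ℝ) → ℝ≥0∞)
      (Function.update v i z) ∂I.dist i =
        I.dist i {z | i ∈ M.alloc (Function.update v i z)} := fun v =>
    lintegral_indicator_one ((measurable_update v) (M.measurable_alloc i))
  simp_rw [h2] at h
  have h3 := integral_toReal (μ := I.law)
    (f := fun v => I.dist i {z | i ∈ M.alloc (Function.update v i z)})
    (measurable_measure_prodMk_left (ν := I.dist i)
      (measurable_update_prod i (M.measurable_alloc i))).aemeasurable
    (ae_of_all _ fun v => measure_lt_top _ _)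
  calc _ = _ := h3
    _ = M.serveProb i := by rw [serveProb, BSMD.law, h]

variable {M}

/-- Given the other values, an agent faces a take-it-or-leave-it price. -/
lemma Truthful.exists_price (hM : M.Truthful) {v : Fin n → ℝ} (hv : 0 ≤ v) (i : Fin n) :
    ∃ t : ℝ, ∀ z, 0 ≤ z → i ∈ M.alloc (Function.update v i z) →
      M.pay (Function.update v i z) i = t ∧ t ≤ z := by
  by_cases h : ∃ z, 0 ≤ z ∧ i ∈ M.alloc (Function.update v i z)
  · obtain ⟨z₀, hz₀, hi₀⟩ := h
    have hup : ∀ z, 0 ≤ z → 0 ≤ Function.update v i z := fun z hz j => by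
      by_cases hj : j = i
      · subst hj; simpa using hz
      · simpa [Function.update_of_ne hj] using hv j
    refine ⟨M.pay (Function.update v i z₀) i, fun z hz hi => ?_⟩
    -- Two reports at which the agent is served cannot profitably replace each other, so their
    -- payments agree; rationality bounds the common payment by the value.
    have h1 := hM.truthful _ (hup z hz) i z₀ hz₀
    have h2 := hM.truthful _ (hup z₀ hz₀) i z hz
    have h3 := hM.rational _ (hup z hz) i
    simp only [utility, Function.update_idem, Function.update_self, hi, hi₀, if_true] at h1 h2 h3
    constructor <;> linarith
  · exact ⟨0, fun z hz hi => absurd ⟨z, hz, hi⟩ h⟩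

/-- Only values of at least `t` are served, so the conditional serving probability `q` is at most
`P(V ≥ t)`; hence `t` is at most the quantile price at `q`. -/
lemma Truthful.lintegral_pay_le_revenueCurve (hM : M.Truthful) {v : Fin n → ℝ} (hv : 0 ≤ v)
    (i : Fin n) :
    ∫⁻ z, ENNReal.ofReal (M.pay (Function.update v i z) i) ∂I.dist i ≤
      ENNReal.ofReal (revenueCurve (I.dist i) (M.condServeProb i v)) := by
  obtain ⟨t, ht⟩ := hM.exists_price hv i
  set A : Set ℝ := {z | i ∈ M.alloc (Function.update v i z)} with hA
  have hAm : MeasurableSet A := (measurable_update v) (M.measurable_alloc i)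
  have hle : ∫⁻ z, ENNReal.ofReal (M.pay (Function.update v i z) i) ∂I.dist i ≤
      ENNReal.ofReal t * I.dist i A := by
    rw [← lintegral_indicator_const hAm]
    refine lintegral_mono_ae ?_
    filter_upwards [I.ae_dist_nonneg i] with z hz
    by_cases hi : z ∈ A
    · rw [indicator_of_mem hi, (ht z hz hi).1]
    · rw [indicator_of_notMem hi, hM.pay_unserved _ _ i hi, ENNReal.ofReal_zero]
      intro j
      by_cases hj : j = i
      · subst hj; simpa using hz
      · simpa [Function.update_of_ne hj] using hv j
  refine hle.trans ?_
  have hq : I.dist i A = ENNReal.ofReal (M.condServeProb i v) := by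
    rw [condServeProb, ofReal_measureReal]
  rw [hq, ← ENNReal.ofReal_mul' (M.condServeProb_mem i v).1, mul_comm, revenueCurve]
  rcases (M.condServeProb_mem i v).1.eq_or_lt with h | h
  · simp [← h]
  · refine ENNReal.ofReal_le_ofReal (mul_le_mul_of_nonneg_left (le_quantilePrice h ?_) h.le)
    rw [condServeProb, acceptProb, measureReal_def]
    refine ENNReal.toReal_mono (measure_ne_top _ _) (measure_mono_ae ?_)
    filter_upwards [I.ae_dist_nonneg i] with z hz hi using (ht z hz hi).2

lemma Truthful.lintegral_pay_le_lintegral_revenueCurve (hM : M.Truthful) (i : Fin n) :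
    ∫⁻ v, ENNReal.ofReal (M.pay v i) ∂I.law ≤
      ∫⁻ v, ENNReal.ofReal (revenueCurve (I.dist i) (M.condServeProb i v)) ∂I.law := by
  rw [BSMD.law, lintegral_resample I.dist i (M.measurable_pay i).ennreal_ofReal]
  refine lintegral_mono_ae ?_
  filter_upwards [I.ae_nonneg] with v hv using hM.lintegral_pay_le_revenueCurve hv i

/-- If `c` is the value at the serving probability of an affine majorant of the revenue curve, the
expected payment is at most `c`. -/
lemma Truthful.lintegral_pay_le_of_affine (hM : M.Truthful) (i : Fin n) {c s : ℝ}
    (h : ∀ r ∈ Icc (0 : ℝ) 1, revenueCurve (I.dist i) r ≤ c + s * (r - M.serveProb i)) :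
    ∫⁻ v, ENNReal.ofReal (M.pay v i) ∂I.law ≤ ENNReal.ofReal c := by
  refine (hM.lintegral_pay_le_lintegral_revenueCurve i).trans ?_
  have hint : Integrable (fun v => s * (M.condServeProb i v - M.serveProb i)) I.law :=
    ((M.integrable_condServeProb i).sub (integrable_const _)).const_mul s
  have hint' : Integrable (fun v => c + s * (M.condServeProb i v - M.serveProb i)) I.law :=
    (integrable_const _).add hint
  calc _ ≤ ∫⁻ v, ENNReal.ofReal (c + s * (M.condServeProb i v - M.serveProb i)) ∂I.law :=
        lintegral_mono fun v => ENNReal.ofReal_le_ofReal (h _ (M.condServeProb_mem i v))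
    _ = ENNReal.ofReal (∫ v, (c + s * (M.condServeProb i v - M.serveProb i)) ∂I.law) := by
        rw [ofReal_integral_eq_lintegral_ofReal hint']
        exact ae_of_all _ fun v => (revenueCurve_nonneg (I.nonneg i) (M.condServeProb_mem i v)).trans
          (h _ (M.condServeProb_mem i v))
    _ = ENNReal.ofReal c := by
        -- The linear term integrates to zero because the conditional serving probability has mean
        -- `serveProb`.
        rw [integral_add (integrable_const _) hint, integral_const_mul,
          integral_sub (M.integrable_condServeProb i) (integrable_const _),
          integral_condServeProb]
        simp

/-- At an endpoint a supporting line may fail to exist, but a variable in `[0, 1]` with mean `0` or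
`1` is almost surely constant. -/
lemma Truthful.lintegral_pay_le_of_endpoint (hM : M.Truthful) (i : Fin n)
    (h : M.serveProb i = 0 ∨ M.serveProb i = 1) :
    ∫⁻ v, ENNReal.ofReal (M.pay v i) ∂I.law ≤
      ENNReal.ofReal (revenueCurve (I.dist i) (M.serveProb i)) := by
  refine (hM.lintegral_pay_le_lintegral_revenueCurve i).trans ?_
  have hae : ∀ᵐ v ∂I.law, M.condServeProb i v = M.serveProb i := by
    have hi := M.integral_condServeProb i
    rcases h with h | h <;> rw [h] at hi ⊢
    · exact (integral_eq_zero_iff_of_nonneg (fun v => (M.condServeProb_mem i v).1)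
        (M.integrable_condServeProb i)).1 hi
    · have h1 : ∫ v, (1 - M.condServeProb i v) ∂I.law = 0 := by
        rw [integral_sub (integrable_const _) (M.integrable_condServeProb i), hi]; simp
      have := (integral_eq_zero_iff_of_nonneg (fun v => sub_nonneg.2 (M.condServeProb_mem i v).2)
        ((integrable_const _).sub (M.integrable_condServeProb i))).1 h1
      filter_upwards [this] with v hv
      simp only [Pi.zero_apply] at hv
      linarith
  calc _ = ∫⁻ _v, ENNReal.ofReal (revenueCurve (I.dist i) (M.serveProb i)) ∂I.law := by
        refine lintegral_congr_ae ?_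
        filter_upwards [hae] with v hv
        rw [hv]
    _ ≤ _ := by simp

lemma Truthful.revenue_le (hM : M.Truthful) {c : Fin n → ℝ} (hc : ∀ i, 0 ≤ c i)
    (h : ∀ i, ∫⁻ v, ENNReal.ofReal (M.pay v i) ∂I.law ≤ ENNReal.ofReal (c i)) :
    M.revenue ≤ ENNReal.ofReal (∑ i, c i) := by
  have h1 : M.revenue = ∫⁻ v, ∑ i, ENNReal.ofReal (M.pay v i) ∂I.law := by
    refine lintegral_congr_ae ?_
    filter_upwards [I.ae_nonneg] with v hv
    exact ENNReal.ofReal_sum_of_nonneg fun i _ => hM.pay_nonneg v hv i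
  rw [h1, lintegral_finsetSum _ fun i _ => (M.measurable_pay i).ennreal_ofReal,
    ENNReal.ofReal_sum_of_nonneg fun i _ => hc i]
  exact Finset.sum_le_sum fun i _ => h i

end Mechanism

/-! ### Ironed revenue curves -/

lemma _root_.ConcaveOn.exists_affine_majorant {S : Set ℝ} {f : ℝ → ℝ} (hf : ConcaveOn ℝ S f)
    {q : ℝ} (hq : q ∈ interior S) : ∃ s, ∀ r ∈ S, f r ≤ f q + s * (r - q) := by
  have hg : ConvexOn ℝ S (-f) := hf.neg
  refine ⟨-derivWithin (-f) (Ioi q) q, fun r hr => ?_⟩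
  rcases lt_trichotomy r q with h | rfl | h
  · have h1 := (hg.slope_le_leftDeriv_of_mem_interior hr hq h).trans
      (hg.leftDeriv_le_rightDeriv_of_mem_interior hq)
    rw [slope_def_field, div_le_iff₀ (sub_pos.2 h)] at h1
    simp only [Pi.neg_apply] at h1
    linarith
  · simp
  · have h1 := hg.rightDeriv_le_slope_of_mem_interior hq hr h
    rw [slope_def_field, le_div_iff₀ (sub_pos.2 h)] at h1
    simp only [Pi.neg_apply] at h1
    linarith

section Ironed

variable {μ : Measure ℝ} [IsProbabilityMeasure μ]

lemma exists_revenueCurve_le (h0 : μ (Iio 0) = 0)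
    (hb : BddAbove (range fun v : ℝ => v * acceptProb μ v)) :
    ∃ C, ∀ r ∈ Icc (0 : ℝ) 1, revenueCurve μ r ≤ C := by
  obtain ⟨C, hC⟩ := hb
  refine ⟨C, fun r hr => ?_⟩
  rcases hr.1.eq_or_lt with rfl | h
  · rw [revenueCurve_zero]
    simpa using hC ⟨0, rfl⟩
  · refine le_trans ?_ (hC ⟨quantilePrice μ r, rfl⟩)
    simp only
    rw [revenueCurve, mul_comm]
    exact mul_le_mul_of_nonneg_left (le_acceptProb_quantilePrice h0 h hr.2)
      (quantilePrice_nonneg h0 hr)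

lemma ironedCurve_le {μ : Measure ℝ} {h : ℝ → ℝ} (hh : ConcaveOn ℝ (Icc 0 1) h)
    (hR : ∀ r ∈ Icc (0 : ℝ) 1, revenueCurve μ r ≤ h r) {q : ℝ} (hq : q ∈ Icc (0 : ℝ) 1) :
    ironedCurve μ q ≤ h q := by
  refine csInf_le ⟨revenueCurve μ q, ?_⟩ ⟨h, hh, hR, rfl⟩
  rintro _ ⟨h', -, hR', rfl⟩
  exact hR' q hq

variable (h0 : μ (Iio 0) = 0) (hb : BddAbove (range fun v : ℝ => v * acceptProb μ v))
include h0 hb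

/-- Bounded single-agent revenue makes a constant a concave majorant, so the infimum is over a
nonempty set and not a default value. -/
lemma le_ironedCurve {y q : ℝ} (h : ∀ h : ℝ → ℝ, ConcaveOn ℝ (Icc 0 1) h →
    (∀ r ∈ Icc (0 : ℝ) 1, revenueCurve μ r ≤ h r) → y ≤ h q) : y ≤ ironedCurve μ q := by
  obtain ⟨C, hC⟩ := exists_revenueCurve_le h0 hb
  refine le_csInf ⟨C, fun _ => C, concaveOn_const C (convex_Icc 0 1), hC, rfl⟩ ?_
  rintro _ ⟨h', hh', hR', rfl⟩
  exact h h' hh' hR'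

lemma revenueCurve_le_ironedCurve {q : ℝ} (hq : q ∈ Icc (0 : ℝ) 1) :
    revenueCurve μ q ≤ ironedCurve μ q :=
  le_ironedCurve h0 hb fun _ _ hR => hR q hq

lemma concaveOn_ironedCurve : ConcaveOn ℝ (Icc 0 1) (ironedCurve μ) := by
  refine ⟨convex_Icc 0 1, fun x hx y hy a b ha hb' hab => ?_⟩
  refine le_ironedCurve h0 hb fun h hh hR => ?_
  refine le_trans ?_ (hh.2 hx hy ha hb' hab)
  simp only [smul_eq_mul]
  exact add_le_add (mul_le_mul_of_nonneg_left (ironedCurve_le hh hR hx) ha)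
    (mul_le_mul_of_nonneg_left (ironedCurve_le hh hR hy) hb')

/-- Endpoints are extreme points of `[0, 1]`: a constant majorant lowered to the curve at one
endpoint stays concave. -/
lemma ironedCurve_endpoint {q : ℝ} (hq : q = 0 ∨ q = 1) :
    ironedCurve μ q = revenueCurve μ q := by
  have hqI : q ∈ Icc (0 : ℝ) 1 := by rcases hq with rfl | rfl <;> simp
  refine le_antisymm ?_ (revenueCurve_le_ironedCurve h0 hb hqI)
  obtain ⟨C, hC⟩ := exists_revenueCurve_le h0 hb
  have hc : ConcaveOn ℝ (Icc (0 : ℝ) 1) fun r => if r = q then revenueCurve μ q else C := by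
    refine concaveOn_iff_pairwise_pos.2
      ⟨convex_Icc 0 1, fun x hx y hy hxy a b ha hb' hab => ?_⟩
    have hle : ∀ r, (if r = q then revenueCurve μ q else C) ≤ C := fun r => by
      split_ifs
      exacts [hC q hqI, le_rfl]
    have hne : a • x + b • y ≠ q := by
      simp only [smul_eq_mul]
      intro h
      apply hxy
      rcases hq with rfl | rfl
      · have h1 := mul_nonneg ha.le hx.1
        have h2 := mul_nonneg hb'.le hy.1
        have h3 : x = 0 := (mul_eq_zero.1 (by linarith : a * x = 0)).resolve_left ha.ne'
        have h4 : y = 0 := (mul_eq_zero.1 (by linarith : b * y = 0)).resolve_left hb'.ne'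
        rw [h3, h4]
      · have h1 := mul_nonneg ha.le (sub_nonneg.2 hx.2)
        have h2 := mul_nonneg hb'.le (sub_nonneg.2 hy.2)
        have h3 : 1 - x = 0 :=
          (mul_eq_zero.1 (by linarith : a * (1 - x) = 0)).resolve_left ha.ne'
        have h4 : 1 - y = 0 :=
          (mul_eq_zero.1 (by linarith : b * (1 - y) = 0)).resolve_left hb'.ne'
        linarith
    simp only [if_neg hne]
    calc _ ≤ a • C + b • C := add_le_add (smul_le_smul_of_nonneg_left (hle x) ha.le)
            (smul_le_smul_of_nonneg_left (hle y) hb'.le)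
      _ = C := by rw [← add_smul, hab, one_smul]
  have := ironedCurve_le hc (fun r hr => by
    split_ifs with h
    · rw [h]
    · exact hC r hr) hqI
  simpa using this

end Ironed

/-! ### Regular distributions -/

section Regular

variable {μ : Measure ℝ} [IsProbabilityMeasure μ]

lemma measurable_measure_Ioi {μ : Measure ℝ} : Measurable fun x : ℝ => μ (Ioi x) :=
  Antitone.measurable fun _ _ h => measure_mono (Ioi_subset_Ioi h)

/-- Tonelli on `{t ≤ y < s, y < x}`; this replaces integration by parts and needs no smoothness. -/
lemma setLIntegral_measure_Ioi (t s : ℝ) :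
    ∫⁻ x in Ico t s, μ (Ioi x) =
      ∫⁻ x in Ico t s, ENNReal.ofReal (x - t) ∂μ + ENNReal.ofReal (s - t) * μ (Ici s) := by
  set T : Set (ℝ × ℝ) := {z | z.2 ∈ Ico t s ∧ z.2 < z.1} with hT
  have hTm : MeasurableSet T :=
    (measurable_snd measurableSet_Ico).inter (measurableSet_lt measurable_snd measurable_fst)
  have h1 := Measure.prod_apply (μ := μ) (ν := volume) hTm
  rw [Measure.prod_apply_symm hTm] at h1
  have h2 : ∀ y : ℝ, μ ((fun x => (x, y)) ⁻¹' T) =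
      (Ico t s).indicator (fun x => μ (Ioi x)) y := by
    intro y
    by_cases hy : y ∈ Ico t s
    · rw [indicator_of_mem hy]
      congr 1
      ext x
      simp [hT, hy.1, hy.2]
    · rw [indicator_of_notMem hy]
      have : (fun x : ℝ => (x, y)) ⁻¹' T = ∅ := by
        ext x
        simp only [hT, mem_preimage, mem_ofPred_eq, mem_empty_iff_false, iff_false]
        exact fun h => hy h.1
      rw [this, measure_empty]
  have h3 : ∀ x : ℝ, volume (Prod.mk x ⁻¹' T) =
      (Ico t s).indicator (fun x => ENNReal.ofReal (x - t)) x +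
        (Ici s).indicator (fun _ => ENNReal.ofReal (s - t)) x := by
    intro x
    have : Prod.mk x ⁻¹' T = Ico t (min x s) := by
      ext y
      simp only [hT, mem_preimage, mem_ofPred_eq, mem_Ico, lt_min_iff]
      tauto
    rw [this, Real.volume_Ico]
    rcases lt_or_ge x s with hx | hx
    · rw [min_eq_left hx.le, indicator_of_notMem (notMem_Ici.2 hx), add_zero]
      rcases lt_or_ge x t with hx' | hx'
      · rw [indicator_of_notMem (by simp [hx']), ENNReal.ofReal_eq_zero.2 (by linarith)]
      · rw [indicator_of_mem (mem_Ico.2 ⟨hx', hx⟩)]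
    · rw [min_eq_right hx, indicator_of_notMem (by simp [hx]), indicator_of_mem (by simpa using hx),
        zero_add]
  simp_rw [h2, h3] at h1
  rw [lintegral_indicator measurableSet_Ico, lintegral_add_right _
    (measurable_const.indicator measurableSet_Ici), lintegral_indicator measurableSet_Ico,
    lintegral_indicator_const measurableSet_Ici] at h1
  exact h1

lemma setLIntegral_ofReal_sub_ne_top (t s : ℝ) :
    ∫⁻ x in Ico t s, ENNReal.ofReal (x - t) ∂μ ≠ ⊤ := by
  refine ((setLIntegral_mono (g := fun _ => ENNReal.ofReal (s - t)) measurable_const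
    fun x hx => ENNReal.ofReal_le_ofReal (by linarith [hx.2])).trans_lt ?_).ne
  rw [setLIntegral_const]
  exact ENNReal.mul_lt_top ENNReal.ofReal_lt_top (measure_lt_top _ _)

lemma setLIntegral_ofReal_sub_of_le {μ : Measure ℝ} {c t : ℝ} (hct : c ≤ t) (s : ℝ) :
    ∫⁻ x in Ico t s, ENNReal.ofReal (x - c) ∂μ =
      ∫⁻ x in Ico t s, ENNReal.ofReal (x - t) ∂μ + ENNReal.ofReal (t - c) * μ (Ico t s) := by
  rw [← setLIntegral_const, ← lintegral_add_right _ measurable_const]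
  refine setLIntegral_congr_fun measurableSet_Ico fun x hx => ?_
  rw [← ENNReal.ofReal_add (by linarith [hx.1]) (by linarith)]
  congr 1
  ring

lemma acceptProb_eq_add {t s : ℝ} (hts : t ≤ s) :
    acceptProb μ t = μ.real (Ico t s) + acceptProb μ s := by
  have h : Ici t = Ico t s ∪ Ici s := (Ico_union_Ici_eq_Ici hts).symm
  have := measureReal_union (μ := μ) (s₁ := Ico t s) (s₂ := Ici s)
    (by rw [Set.disjoint_left]; intro x hx hx'; exact absurd hx' (not_le.2 hx.2)) measurableSet_Ici
  rw [← h] at this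
  exact this

namespace IsDensity

lemma measure_eq_zero {μ : Measure ℝ} {f : ℝ → ℝ≥0∞} (hd : IsDensity μ f) : μ {x | f x = 0} = 0 := by
  have hZ : MeasurableSet {x | f x = 0} := hd.measurable (measurableSet_singleton 0)
  have h := congrArg (fun ν : Measure ℝ => ν {x | f x = 0}) hd.eq_add
  simp only [Measure.add_apply, withDensity_apply _ hZ] at h
  rw [h, setLIntegral_congr_fun hZ (g := fun _ => 0) (fun x hx => hx), lintegral_zero,
    Measure.restrict_apply hZ, zero_add]
  have : {x | f x = 0} ∩ {x | f x = ⊤} = ∅ := by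
    ext x
    simp only [mem_inter_iff, mem_ofPred_eq, mem_empty_iff_false, iff_false, not_and]
    intro h h'
    simp [h] at h'
  rw [this, measure_empty]

/-- Atoms contribute nothing, since the quotient vanishes where `f = ⊤`. -/
lemma setLIntegral_inverseHazard {μ : Measure ℝ} {f : ℝ → ℝ≥0∞}
    (hd : IsDensity μ f) {A : Set ℝ} (hA : MeasurableSet A) :
    ∫⁻ x in A, μ (Ioi x) / f x ∂μ = ∫⁻ x in A, f x * (μ (Ioi x) / f x) := by
  have hm : Measurable fun x => μ (Ioi x) / f x := measurable_measure_Ioi.div hd.measurable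
  have hT : MeasurableSet {x | f x = ⊤} := hd.measurable (measurableSet_singleton ⊤)
  have h := congrArg (fun ν : Measure ℝ => ∫⁻ x in A, μ (Ioi x) / f x ∂ν) hd.eq_add
  refine h.trans ?_
  rw [Measure.restrict_add, lintegral_add_measure, restrict_withDensity hA,
    lintegral_withDensity_eq_lintegral_mul _ hd.measurable hm]
  have hz : ∫⁻ x in A, μ (Ioi x) / f x ∂(μ.restrict {x | f x = ⊤}) = 0 := by
    refine le_antisymm ((setLIntegral_le_lintegral _ _).trans ?_) zero_le
    rw [setLIntegral_congr_fun hT (g := fun _ => 0)]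
    · simp
    · intro x hx
      have hx' : f x = ⊤ := hx
      simp [hx', ENNReal.div_top]
  rw [hz, add_zero]
  rfl

variable {f : ℝ → ℝ≥0∞} (hd : IsDensity μ f)
include hd

lemma ae_lt_top : ∀ᵐ x, f x < ⊤ := by
  refine MeasureTheory.ae_lt_top hd.measurable (ne_of_lt ?_)
  have h := congrArg (fun ν : Measure ℝ => ν univ) hd.eq_add
  simp only [Measure.add_apply, withDensity_apply _ MeasurableSet.univ, setLIntegral_univ] at h
  exact (le_self_add.trans h.ge).trans_lt (measure_lt_top _ _)

/-- Virtual values at most `c` below `p` mean that `(t - c) * P(V ≥ t)` increases up to `p`; the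
proof is the integrated form of this derivative test. -/
lemma lagrangian_le_of_le {t p c : ℝ} (htp : t ≤ p) (hct : c ≤ t)
    (h : ∀ x < p, ENNReal.ofReal (x - c) ≤ μ (Ioi x) / f x) :
    (t - c) * acceptProb μ t ≤ (p - c) * acceptProb μ p := by
  have h1 : ∫⁻ x in Ico t p, ENNReal.ofReal (x - c) ∂μ ≤ ∫⁻ x in Ico t p, μ (Ioi x) := by
    calc _ ≤ ∫⁻ x in Ico t p, μ (Ioi x) / f x ∂μ :=
          setLIntegral_mono (measurable_measure_Ioi.div hd.measurable) fun x hx => h x hx.2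
      _ = ∫⁻ x in Ico t p, f x * (μ (Ioi x) / f x) := hd.setLIntegral_inverseHazard measurableSet_Ico
      _ ≤ _ := setLIntegral_mono measurable_measure_Ioi fun x _ => ENNReal.mul_div_le
  rw [setLIntegral_measure_Ioi t p, setLIntegral_ofReal_sub_of_le hct,
    ENNReal.add_le_add_iff_left (setLIntegral_ofReal_sub_ne_top t p), ← ofReal_measureReal,
    ← ofReal_acceptProb, ← ENNReal.ofReal_mul (by linarith), ← ENNReal.ofReal_mul (by linarith),
    ENNReal.ofReal_le_ofReal_iff (mul_nonneg (by linarith) (acceptProb_nonneg _))] at h1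
  rw [acceptProb_eq_add htp]
  linarith

lemma lagrangian_le_of_ge {p s c : ℝ} (hps : p ≤ s) (hcp : c ≤ p)
    (h : ∀ x, p ≤ x → μ (Ioi x) / f x ≤ ENNReal.ofReal (x - c)) :
    (s - c) * acceptProb μ s ≤ (p - c) * acceptProb μ p := by
  have h1 : ∫⁻ x in Ico p s, μ (Ioi x) ≤ ∫⁻ x in Ico p s, ENNReal.ofReal (x - c) ∂μ := by
    calc ∫⁻ x in Ico p s, μ (Ioi x) ≤ ∫⁻ x in Ico p s, f x * (μ (Ioi x) / f x) := by
          refine setLIntegral_mono_ae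
            (hd.measurable.mul (measurable_measure_Ioi.div hd.measurable)).aemeasurable ?_
          filter_upwards [hd.ae_lt_top] with x hx hxI
          -- Where the density vanishes, `h` bounds the quotient by a finite number, which forces `μ
          -- (Ioi x) = 0`.
          by_cases hf : f x = 0
          · have := h x hxI.1
            by_cases hI : μ (Ioi x) = 0
            · simp [hI]
            · rw [hf, ENNReal.div_zero hI] at this
              exact absurd this (by simp)
          · rw [ENNReal.mul_div_cancel hf hx.ne]
      _ = ∫⁻ x in Ico p s, μ (Ioi x) / f x ∂μ :=
          (hd.setLIntegral_inverseHazard measurableSet_Ico).symm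
      _ ≤ _ := setLIntegral_mono (by fun_prop) fun x hx => h x hx.1
  rw [setLIntegral_measure_Ioi p s, setLIntegral_ofReal_sub_of_le hcp,
    ENNReal.add_le_add_iff_left (setLIntegral_ofReal_sub_ne_top p s), ← ofReal_acceptProb,
    ← ofReal_measureReal (s := Ico p s), ← ENNReal.ofReal_mul (by linarith), ← ENNReal.ofReal_mul (by linarith),
    ENNReal.ofReal_le_ofReal_iff (mul_nonneg (by linarith) measureReal_nonneg)] at h1
  rw [acceptProb_eq_add hps]
  linarith

end IsDensity

lemma virtualValue_of_eq_top {μ : Measure ℝ} {f : ℝ → ℝ≥0∞} {x : ℝ}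
    (h : μ (Ioi x) / f x = ⊤) : virtualValue μ f x = ⊥ := by
  rw [virtualValue, h]
  simp

lemma virtualValue_of_ne_top {μ : Measure ℝ} {f : ℝ → ℝ≥0∞} {x : ℝ}
    (h : μ (Ioi x) / f x ≠ ⊤) :
    virtualValue μ f x = ((x - (μ (Ioi x) / f x).toReal : ℝ) : EReal) := by
  rw [virtualValue, EReal.coe_sub, EReal.coe_ennreal_toReal h]

lemma inverseHazard_le_of_le_virtualValue {μ : Measure ℝ} {f : ℝ → ℝ≥0∞} {x c : ℝ}
    (h : (c : EReal) ≤ virtualValue μ f x) :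
    c ≤ x ∧ μ (Ioi x) / f x ≤ ENNReal.ofReal (x - c) := by
  by_cases ht : μ (Ioi x) / f x = ⊤
  · rw [virtualValue_of_eq_top ht] at h
    simp at h
  · rw [virtualValue_of_ne_top ht, EReal.coe_le_coe_iff] at h
    have := ENNReal.toReal_nonneg (a := μ (Ioi x) / f x)
    exact ⟨by linarith, (ENNReal.le_ofReal_iff_toReal_le ht (by linarith)).2 (by linarith)⟩

lemma ofReal_sub_le_of_virtualValue_le {μ : Measure ℝ} {f : ℝ → ℝ≥0∞} {x c : ℝ}
    (h : virtualValue μ f x ≤ c) : ENNReal.ofReal (x - c) ≤ μ (Ioi x) / f x := by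
  by_cases ht : μ (Ioi x) / f x = ⊤
  · simp [ht]
  · rw [virtualValue_of_ne_top ht, EReal.coe_le_coe_iff] at h
    exact (ENNReal.ofReal_le_iff_le_toReal ht).2 (by linarith)

/-- The revenue curve of a regular distribution lies below a line through any interior point. -/
lemma exists_affine_majorant_of_isRegular (h0 : μ (Iio 0) = 0) {f : ℝ → ℝ≥0∞}
    (hd : IsDensity μ f) (hreg : IsRegular μ f) {q : ℝ} (hq0 : 0 < q) (hq1 : q < 1) :
    ∃ s, ∀ r ∈ Icc (0 : ℝ) 1, revenueCurve μ r ≤ revenueCurve μ q + s * (r - q) := by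
  set p := quantilePrice μ q with hp
  have hqp : q ≤ acceptProb μ p := le_acceptProb_quantilePrice h0 hq0 hq1.le
  -- The slope `c` is the virtual value at `p`. Without an atom at `p` the acceptance probability is
  -- exactly `q`; at an atom `c = p` and both sides vanish.
  obtain ⟨c, hcφ, hcq⟩ : ∃ c : ℝ, virtualValue μ f p = c ∧ (p - c) * acceptProb μ p = (p - c) * q := by
    by_cases hat : μ {p} = 0
    · have hqe : acceptProb μ p = q := by
        refine le_antisymm ?_ hqp
        have h1 : μ (Ici p) ≤ ENNReal.ofReal q := by
          calc μ (Ici p) ≤ μ {p} + μ (Ioi p) := by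
                rw [← Ioi_union_left, union_comm]; exact measure_union_le _ _
            _ ≤ ENNReal.ofReal q := by
                rw [hat, zero_add]; exact measure_Ioi_quantilePrice_le hq0
        exact ENNReal.toReal_le_of_le_ofReal hq0.le h1
      have hlt : μ (Iio p) ≠ 0 := by
        intro h
        have h2 : μ (Ici p) = 1 := by
          rw [prob_compl_eq_zero_iff measurableSet_Ici |>.symm, compl_Ici, h]
        rw [acceptProb, h2] at hqe
        simp at hqe
        linarith
      -- The density is nonzero somewhere below `p`, so the virtual value is finite there, and
      -- monotonicity keeps it above `-∞` at `p`.
      obtain ⟨v, hvp, hv⟩ : ∃ v, v < p ∧ f v ≠ 0 := by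
        by_contra! h
        exact hlt (measure_mono_null (fun v hv => h v hv) hd.measure_eq_zero)
      have hbot : virtualValue μ f v ≠ ⊥ := by
        rw [virtualValue_of_ne_top (ENNReal.div_ne_top (measure_ne_top _ _) hv)]
        exact EReal.coe_ne_bot _
      have h3 : virtualValue μ f p ≠ ⊥ := ne_bot_of_le_ne_bot hbot (hreg hvp.le)
      have h4 : virtualValue μ f p ≠ ⊤ := by
        rw [virtualValue_of_ne_top fun h => h3 (virtualValue_of_eq_top h)]
        exact EReal.coe_ne_top _
      exact ⟨(virtualValue μ f p).toReal, (EReal.coe_toReal h4 h3).symm, by rw [hqe]⟩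
    · refine ⟨p, ?_, by simp⟩
      rw [virtualValue, (hd.eq_top_iff p).2 hat, ENNReal.div_top]
      simp
  have hcp : c ≤ p := (inverseHazard_le_of_le_virtualValue hcφ.ge).1
  have hW : 0 ≤ (p - c) * q := mul_nonneg (by linarith) hq0.le
  have hmax : ∀ t, c ≤ t → (t - c) * acceptProb μ t ≤ (p - c) * q := by
    intro t hct
    rw [← hcq]
    rcases le_total t p with htp | hpt
    · exact hd.lagrangian_le_of_le htp hct fun x hx =>
        ofReal_sub_le_of_virtualValue_le ((hreg hx.le).trans hcφ.le)
    · exact hd.lagrangian_le_of_ge hpt hcp fun x hx =>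
        (inverseHazard_le_of_le_virtualValue (hcφ.ge.trans (hreg hx))).2
  refine ⟨c, fun r hr => ?_⟩
  have key : (quantilePrice μ r - c) * r ≤ (p - c) * q := by
    rcases hr.1.eq_or_lt with rfl | hr0
    · simpa using hW
    rcases le_total c (quantilePrice μ r) with h | h
    · exact (mul_le_mul_of_nonneg_left (le_acceptProb_quantilePrice h0 hr0 hr.2)
        (sub_nonneg.2 h)).trans (hmax _ h)
    · exact (mul_nonpos_of_nonpos_of_nonneg (sub_nonpos.2 h) hr.1).trans hW
  simp only [revenueCurve]
  linarith

end Regular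

/-! ### Existence of optimal lotteries -/

/-- A line that is lowest at `q` among the affine majorants of an upper semicontinuous function
on `[0, 1]` touches its graph at a point of `[0, q]`. -/
lemma exists_contact_left {f : ℝ → ℝ} (hf : UpperSemicontinuousOn f (Icc 0 1)) {a b q : ℝ}
    (hq : q ∈ Icc (0 : ℝ) 1) (hle : ∀ r ∈ Icc (0 : ℝ) 1, f r ≤ a + b * r)
    (hmin : ∀ a' b' : ℝ, (∀ r ∈ Icc (0 : ℝ) 1, f r ≤ a' + b' * r) → a + b * q ≤ a' + b' * q) :
    ∃ r ∈ Icc 0 q, f r = a + b * r := by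
  by_contra! hne
  have hg : UpperSemicontinuousOn (fun r => f r + -(a + b * r)) (Icc 0 1) :=
    hf.add (Continuous.continuousOn (by fun_prop)).upperSemicontinuousOn
  have hsub : Icc 0 q ⊆ Icc (0 : ℝ) 1 := Icc_subset_Icc_right hq.2
  obtain ⟨x, hx, hmax⟩ := (hg.mono hsub).exists_isMaxOn ⟨0, left_mem_Icc.2 hq.1⟩ isCompact_Icc
  have hx0 : f x + -(a + b * x) < 0 := by
    have := lt_of_le_of_ne (hle x (hsub hx)) (hne x hx)
    linarith
  set δ := -(f x + -(a + b * x)) / 2 with hδ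
  have hδ0 : 0 < δ := by simp only [hδ]; linarith
  have hmax' : ∀ r ∈ Icc 0 q, f r + -(a + b * r) < -δ := fun r hr => by
    have : f r + -(a + b * r) ≤ f x + -(a + b * x) := hmax hr
    simp only [hδ] at hδ0 ⊢
    linarith
  -- Upper semicontinuity extends the gap `δ` from `[0, q]` to slightly beyond `q`.
  have hev := hg q hq (-δ) (hmax' q ⟨hq.1, le_rfl⟩)
  obtain ⟨η, hη0, hη⟩ := Metric.mem_nhdsWithin_iff.1 hev
  -- The line is tilted by `δ / 2` about the abscissa `q + min η 1`. To its left the line drops by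
  -- at most `δ`, as that abscissa is at most `2`; to its right it rises. The new majorant is
  -- strictly lower at `q`.
  have key := hmin (a - δ / 2 * (q + min η 1)) (b + δ / 2) fun r hr => by
    have hm0 : 0 < min η 1 := lt_min hη0 one_pos
    have hm1 : min η 1 ≤ 1 := min_le_right _ _
    rcases lt_or_ge r (q + min η 1) with h | h
    · have hlt : f r + -(a + b * r) < -δ := by
        rcases le_total r q with h' | h'
        · exact hmax' r ⟨hr.1, h'⟩
        · refine hη ⟨?_, hr⟩
          rw [Metric.mem_ball, Real.dist_eq, abs_of_nonneg (by linarith)]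
          linarith [min_le_left η 1]
      nlinarith [hr.1, hq.2]
    · nlinarith [hle r hr]
  have hm0 : 0 < min η 1 := lt_min hη0 one_pos
  nlinarith [mul_pos hδ0 hm0]

lemma exists_contact_right {f : ℝ → ℝ} (hf : UpperSemicontinuousOn f (Icc 0 1)) {a b q : ℝ}
    (hq : q ∈ Icc (0 : ℝ) 1) (hle : ∀ r ∈ Icc (0 : ℝ) 1, f r ≤ a + b * r)
    (hmin : ∀ a' b' : ℝ, (∀ r ∈ Icc (0 : ℝ) 1, f r ≤ a' + b' * r) → a + b * q ≤ a' + b' * q) :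
    ∃ r ∈ Icc q 1, f r = a + b * r := by
  have hmaps : MapsTo (fun r : ℝ => 1 - r) (Icc 0 1) (Icc 0 1) := fun r hr =>
    ⟨sub_nonneg.2 hr.2, sub_le_self _ hr.1⟩
  have hf' : UpperSemicontinuousOn (fun r => f (1 - r)) (Icc 0 1) := fun r hr y hy =>
    ((continuous_const.sub continuous_id).continuousWithinAt.tendsto_nhdsWithin hmaps).eventually
      (hf (1 - r) (hmaps hr) y hy)
  obtain ⟨r, hr, h⟩ := exists_contact_left hf' (a := a + b) (b := -b) (hmaps hq)
    (fun r hr => by have := hle _ (hmaps hr); linarith) fun a' b' h => by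
      have := hmin (a' + b') (-b') fun r hr => by
        have := h (1 - r) (hmaps hr)
        rw [sub_sub_cancel] at this
        linarith
      linarith
  exact ⟨1 - r, ⟨by linarith [hr.2], by linarith [hr.1]⟩, by rw [h]; ring⟩

section Existence

variable {μ : Measure ℝ} [IsProbabilityMeasure μ]

/-- At `q > 0`, prices near `q` cannot jump above any `p` exceeding the price at `q`. At `0` prices
may diverge, and the vanishing tail revenue takes over. -/
lemma upperSemicontinuousOn_revenueCurve (h0 : μ (Iio 0) = 0)
    (hlim : Tendsto (fun v : ℝ => v * acceptProb μ v) atTop (𝓝 0)) :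
    UpperSemicontinuousOn (revenueCurve μ) (Icc 0 1) := by
  intro q hq y hy
  rcases hq.1.eq_or_lt with rfl | hq0
  · rw [revenueCurve_zero] at hy
    obtain ⟨N, hN⟩ := eventually_atTop.1 (hlim.eventually (gt_mem_nhds hy))
    have hev : ∀ᶠ r in 𝓝 (0 : ℝ), r * N < y :=
      (continuous_id.mul continuous_const).continuousAt.eventually (gt_mem_nhds (by simpa using hy))
    filter_upwards [self_mem_nhdsWithin, mem_nhdsWithin_of_mem_nhds hev] with r hr hrN
    rcases hr.1.eq_or_lt with rfl | hr0
    · rwa [revenueCurve_zero]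
    rw [revenueCurve]
    rcases le_total N (quantilePrice μ r) with h | h
    · refine lt_of_le_of_lt ?_ (hN _ h)
      rw [mul_comm]
      exact mul_le_mul_of_nonneg_left (le_acceptProb_quantilePrice h0 hr0 hr.2)
        (quantilePrice_nonneg h0 hr)
    · exact (mul_le_mul_of_nonneg_left h hr.1).trans_lt hrN
  · have hlt : quantilePrice μ q < y / q := by
      rw [lt_div_iff₀ hq0, mul_comm]
      exact hy
    obtain ⟨p, hp, hpy⟩ := exists_between hlt
    rw [lt_div_iff₀ hq0] at hpy
    have hev : ∀ᶠ r in 𝓝 q, p * r < y :=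
      (continuous_const.mul continuous_id).continuousAt.eventually (gt_mem_nhds hpy)
    filter_upwards [self_mem_nhdsWithin, mem_nhdsWithin_of_mem_nhds hev,
      mem_nhdsWithin_of_mem_nhds (lt_mem_nhds (acceptProb_lt_of_quantilePrice_lt hq0 hp))]
      with r hr hry hpr
    have hr0 : 0 < r := (acceptProb_nonneg p).trans_lt hpr
    have hle : quantilePrice μ r ≤ p := by
      by_contra! h
      exact absurd ((le_acceptProb_quantilePrice h0 hr0 hr.2).trans (acceptProb_antitone h.le))
        (not_le.2 hpr)
    rw [revenueCurve, mul_comm]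
    exact (mul_le_mul_of_nonneg_right hle hr0.le).trans_lt hry

lemma exists_isOptimal (h0 : μ (Iio 0) = 0)
    (hb : BddAbove (range fun v : ℝ => v * acceptProb μ v))
    (hlim : Tendsto (fun v : ℝ => v * acceptProb μ v) atTop (𝓝 0)) {q : ℝ}
    (hq : q ∈ Icc (0 : ℝ) 1) : ∃ L : Lottery, L.IsOptimal μ q := by
  by_cases hend : q = 0 ∨ q = 1
  · refine ⟨⟨1, q, q⟩, by simp, hq, hq, by simp, ?_⟩
    rw [ironedCurve_endpoint h0 hb hend]
    simp [Lottery.value]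
  · push Not at hend
    have hint : q ∈ interior (Icc (0 : ℝ) 1) := by
      rw [interior_Icc]
      exact ⟨lt_of_le_of_ne hq.1 hend.1.symm, lt_of_le_of_ne hq.2 hend.2⟩
    obtain ⟨s, hs⟩ := (concaveOn_ironedCurve h0 hb).exists_affine_majorant hint
    have hle : ∀ r ∈ Icc (0 : ℝ) 1, revenueCurve μ r ≤ (ironedCurve μ q - s * q) + s * r :=
      fun r hr => by linarith [revenueCurve_le_ironedCurve h0 hb hr, hs r hr]
    -- An affine majorant is concave, so it lies above the ironed curve: the supporting line is
    -- lowest at `q`.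
    have hmin : ∀ a' b' : ℝ, (∀ r ∈ Icc (0 : ℝ) 1, revenueCurve μ r ≤ a' + b' * r) →
        (ironedCurve μ q - s * q) + s * q ≤ a' + b' * q := fun a' b' h => by
      have hc : ConcaveOn ℝ (Icc (0 : ℝ) 1) fun r => a' + b' * r := by
        refine ⟨convex_Icc 0 1, fun x _ y _ u v _ _ huv => le_of_eq ?_⟩
        simp only [smul_eq_mul]
        linear_combination a' * huv
      linarith [ironedCurve_le hc h hq]
    have husc := upperSemicontinuousOn_revenueCurve h0 hlim
    obtain ⟨lo, hlo, hlo'⟩ := exists_contact_left husc hq hle hmin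
    obtain ⟨hi, hhi, hhi'⟩ := exists_contact_right husc hq hle hmin
    have hseg : q ∈ segment ℝ lo hi := by
      rw [segment_eq_Icc (hlo.2.trans hhi.1)]
      exact ⟨hlo.2, hhi.1⟩
    obtain ⟨x, y, hx, hy, hxy, hxq⟩ := hseg
    obtain rfl : y = 1 - x := by linarith
    simp only [smul_eq_mul] at hxq
    refine ⟨⟨x, lo, hi⟩, ⟨hx, by linarith⟩, ⟨hlo.1, hlo.2.trans hq.2⟩, ⟨hq.1.trans hhi.1, hhi.2⟩,
      hxq, ?_⟩
    simp only [Lottery.value]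
    rw [hlo', hhi']
    linear_combination s * hxq

end Existence

end SeqPosted

/-! ### The approximation bound in both cases -/

theorem mainTheorem6 {n : ℕ} (I : SeqPosted.BSMD n)
    (hI : SeqPosted.IsPartitionMatroid I.feasible) :
    -- regular distributions (possibly with point masses)
    (∀ f : Fin n → ℝ → ℝ≥0∞,
      (∀ i, SeqPosted.IsDensity (I.dist i) (f i)) →
      (∀ i, SeqPosted.IsRegular (I.dist i) (f i)) →
      ∀ M : SeqPosted.Mechanism I,
        M.IsMyerson (fun i => SeqPosted.virtualValue (I.dist i) (f i)) →
        ∀ σ : Equiv.Perm (Fin n),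
          Antitone (fun k => SeqPosted.quantilePrice (I.dist (σ k)) (M.serveProb (σ k))) →
          M.revenue ≤ ENNReal.ofReal (Real.exp 1 / (Real.exp 1 - 1)) *
            I.spmRevenue σ (fun i => SeqPosted.quantileOffer (I.dist i) (M.serveProb i))) ∧
    -- arbitrary distributions with finite single-agent revenue
    ((∀ i, BddAbove (range (fun v : ℝ => v * SeqPosted.acceptProb (I.dist i) v))) →
      ∀ M : SeqPosted.Mechanism I,
        M.IsMyerson (fun i v => (SeqPosted.ironedVirtualValue (I.dist i) v : EReal)) →
        (∀ L : Fin n → SeqPosted.Lottery,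
          (∀ i, (L i).IsOptimal (I.dist i) (M.serveProb i)) →
          ∀ σ : Equiv.Perm (Fin n),
            Antitone (fun k => (L (σ k)).value (I.dist (σ k)) / M.serveProb (σ k)) →
            M.revenue ≤ ENNReal.ofReal (Real.exp 1 / (Real.exp 1 - 1)) *
              I.spmRevenue σ (fun i => (L i).offer (I.dist i))) ∧
        (∀ i, Tendsto (fun v : ℝ => v * SeqPosted.acceptProb (I.dist i) v) atTop (𝓝 0) →
          ∃ L : SeqPosted.Lottery, L.IsOptimal (I.dist i) (M.serveProb i))) := by
  classical
  open SeqPosted in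
  obtain ⟨block, cap, hJ⟩ := hI
  replace hJ : ∀ S : Finset (Fin n),
      S ∈ I.feasible ↔ ∀ j, (S.filter (fun i => block i = j)).card ≤ cap j := by
    intro S
    rw [hJ]
  refine ⟨fun f hd hreg M hM σ hσ => ?_, fun hb M hM => ⟨fun L hL σ hσ => ?_, fun i hlim =>
    exists_isOptimal (I.nonneg i) (hb i) hlim (M.serveProb_mem i)⟩⟩
  -- A regular agent's offer is a degenerate lottery, so both cases share one revenue bound.
  · have hL : ∀ i, (Lottery.mk 1 (M.serveProb i) (M.serveProb i)).IsValid (M.serveProb i) :=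
      fun i => ⟨by simp, M.serveProb_mem i, M.serveProb_mem i, by simp⟩
    have hval : ∀ i, (Lottery.mk 1 (M.serveProb i) (M.serveProb i)).value (I.dist i) =
        revenueCurve (I.dist i) (M.serveProb i) := fun i => by simp [Lottery.value]
    have hoff : ∀ i, (Lottery.mk 1 (M.serveProb i) (M.serveProb i)).offer (I.dist i) =
        quantileOffer (I.dist i) (M.serveProb i) := fun i => by simp [Lottery.offer]
    have hspm := ofReal_sum_value_le_spmRevenue I hJ (M.sum_serveProb_le hJ) hL (σ := σ) (by
      convert hσ using 2 with k
      rw [hval, revenueCurve]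
      by_cases h : M.serveProb (σ k) = 0
      · rw [h, quantilePrice_zero, div_zero]
      · rw [mul_div_cancel_left₀ _ h])
    simp only [hoff] at hspm
    refine (hM.1.revenue_le (fun i => (hL i).value_nonneg (I.nonneg i)) fun i => ?_).trans hspm
    rw [hval]
    by_cases hend : M.serveProb i = 0 ∨ M.serveProb i = 1
    · exact hM.1.lintegral_pay_le_of_endpoint i hend
    · push Not at hend
      obtain ⟨s, hs⟩ := exists_affine_majorant_of_isRegular (I.nonneg i) (hd i) (hreg i)
        (lt_of_le_of_ne (M.serveProb_mem i).1 hend.1.symm)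
        (lt_of_le_of_ne (M.serveProb_mem i).2 hend.2)
      exact hM.1.lintegral_pay_le_of_affine i hs
  · refine (hM.1.revenue_le (fun i => (hL i).isValid.value_nonneg (I.nonneg i)) fun i => ?_).trans
      (ofReal_sum_value_le_spmRevenue I hJ (M.sum_serveProb_le hJ) (fun i => (hL i).isValid) hσ)
    rw [(hL i).value_eq]
    by_cases hend : M.serveProb i = 0 ∨ M.serveProb i = 1
    · rw [ironedCurve_endpoint (I.nonneg i) (hb i) hend]
      exact hM.1.lintegral_pay_le_of_endpoint i hend
    · push Not at hend
      have hint : M.serveProb i ∈ interior (Icc (0 : ℝ) 1) := by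
        rw [interior_Icc]
        exact ⟨lt_of_le_of_ne (M.serveProb_mem i).1 hend.1.symm,
          lt_of_le_of_ne (M.serveProb_mem i).2 hend.2⟩
      obtain ⟨s, hs⟩ := (concaveOn_ironedCurve (I.nonneg i) (hb i)).exists_affine_majorant hint
      exact hM.1.lintegral_pay_le_of_affine i fun r hr =>
        (revenueCurve_le_ironedCurve (I.nonneg i) (hb i) hr).trans (hs r hr)
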